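/- Let $G=(V,E)$ be a finite simple graph with $n=|V|\ge 2$ vertices and let $\mathcal C$ be the set of its odd cycles. Consider the linear program $$\max \sum_{u} c_u x_u\quad\text{s.t.}\quad x_u+x_v\le 1\ (uv\in E),\quad \sum_{u\in C}x_u\le \lfloor |C|/2\rfloor\ (C\in\mathcal C),\quad x\in[0,1]^V. \tag{1}$$ Assume that $G$ is t-perfect, i.e. that (1) has an integral optimal solution for every $c\in\mathbb Z_{\ge 0}^V$. The vertex weights $\tilde c_u$ $(u\in V)$ are independent random variables, $\tilde c_u$ takes values in $\{c_u^-,c_u^-+1,\dots,c_u^+\}$ with given $c_u^-,c_u^+\in\mathbb Z_{\ge 0}$, and $\Pr[\tilde c_u=c_u^+]\ge p$ for all $u$, where $0<p\le 1$. Put $\Delta_c=\max_u(c_u^+-c_u^-)$ and let $0<\varepsilon<1$. The adaptive strategy (Algorithm 1) with $T$ iterations works as follows. In each iteration it finds an optimal solution $x$ to the optimistic LP, which is (1) with the realized weights of the vertices queried so far and the weights $c_u^+$ of all other vertices, and then it queries each vertex $u$ independently with probability $x_u$, which reveals the realized value of $\tilde c_u$. After $T$ iterations it returns a stable set of maximum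 weight with respect to the pessimistic weights, which are the realized weights of the queried vertices and $c_u^-$ for all other vertices. The choice among optimal solutions may depend in any way on what has been revealed so far. There are absolute constants $K,\kappa,L>0$, independent of all the data above, such that the following hold. 1. If $$T\ \ge\ K\,\frac{\Delta_c\,\log n\,\log(n/\varepsilon)}{\varepsilon^3 p},$$ then with probability at least $1-\varepsilon$, over both the weights and the queries, the strategy outputs a stable set whose realized weight is at least $(1-\varepsilon)$ times the maximum realized weight of a stable set. 2. For every $\mu\ge 1$ and every $\theta$ with $0<\theta\le \kappa\varepsilon^2/\log n$, the set $$W=\Bigl\{(y,z)\in\theta\bigl(\mathbb Z_{\ge0}^{E}\times\mathbb Z_{\ge 0}^{\mathcal C}\bigr):\ \sum_{e\in E}y_e+\sum_{C\in\mathcal C}\lfloor |C|/2\rfloor z_C\le (1-\varepsilon/2)\mu\Bigr\}$$ is finite with $|W|\le \exp\bigl(L\,(\mu/\theta)\log n\bigr)$, and it is an $(\varepsilon,\varepsilon/2)$-witness cover for $\mu$: all its members have dual value at most $(1-\varepsilon/2)\mu$, and whenever, for some $c\in\mathbb Z_{\ge0}^V$, some $(y,z)\ge 0$ of dual value $\sum_e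 y_e+\sum_C\lfloor |C|/2\rfloor z_C$ at most $(1-\varepsilon)\mu$ satisfies $\sum_{e\ni u}y_e+\sum_{C\ni u}z_C\ge c_u$ for all $u\in V$, some member of $W$ satisfies these inequalities as well. -/

import Mathlib

open MeasureTheory ProbabilityTheory

noncomputable section

namespace StochPack

/-! ### Packing systems, LP relaxation, dual vectors and witness covers -/

/-- The data of a packing system `A x ≤ b` with nonnegative integral entries; `ι` indexes the
constraints (dual variables) and `V` the elements (primal variables). -/
structure PackingSystem (ι V : Type*) where
  A : ι → V → ℕ
  b : ι → ℕ

namespace PackingSystem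

variable {ι V : Type*} [Fintype ι] [Fintype V]

/-- The feasible region of the LP relaxation: `x ∈ [0,1]^V` with `A x ≤ b`. -/
def relaxation (P : PackingSystem ι V) : Set (V → ℝ) :=
  {x | (∀ j, x j ∈ Set.Icc (0 : ℝ) 1) ∧ ∀ i, ∑ j, (P.A i j : ℝ) * x j ≤ (P.b i : ℝ)}

/-- `x` is an optimal solution to the LP relaxation with the objective vector `c`. -/
def IsLPOptimal (P : PackingSystem ι V) (c : V → ℕ) (x : V → ℝ) : Prop :=
  x ∈ P.relaxation ∧ ∀ x' ∈ P.relaxation, ∑ j, (c j : ℝ) * x' j ≤ ∑ j, (c j : ℝ) * x j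

/-- The dual constraints `yᵀ A ≥ cᵀ` (the sign condition on `y` is stated separately). -/
def DualCovers (P : PackingSystem ι V) (c : V → ℕ) (y : ι → ℝ) : Prop :=
  ∀ j, (c j : ℝ) ≤ ∑ i, y i * (P.A i j : ℝ)

/-- The dual objective value `yᵀ b`. -/
def dualValue (P : PackingSystem ι V) (y : ι → ℝ) : ℝ :=
  ∑ i, y i * (P.b i : ℝ)

/-- `W` is an `(ε, ε')`-witness cover for `μ`: a finite set of nonnegative dual vectors, of value at
most `(1 - ε') μ` each, such that if all of them violate `yᵀ A ≥ cᵀ` for a nonnegative integral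
vector `c`, then so does every nonnegative `y` of value at most `(1 - ε) μ`. -/
def IsWitnessCover (P : PackingSystem ι V) (ε ε' μ : ℝ) (W : Set (ι → ℝ)) : Prop :=
  W.Finite ∧ (∀ y ∈ W, ∀ i, 0 ≤ y i) ∧
  (∀ c : V → ℕ, (∀ y ∈ W, ¬ P.DualCovers c y) →
    ∀ y : ι → ℝ, (∀ i, 0 ≤ y i) → P.dualValue y ≤ (1 - ε) * μ → ¬ P.DualCovers c y) ∧
  ∀ y ∈ W, P.dualValue y ≤ (1 - ε') * μ

/-- The dual vectors whose entries are nonnegative integral multiples of `θ` and whose value is at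
most `(1 - ε / 2) μ`. -/
def discretizedDuals (P : PackingSystem ι V) (θ ε μ : ℝ) : Set (ι → ℝ) :=
  {y | (∃ k : ι → ℕ, ∀ i, y i = θ * (k i : ℝ)) ∧ P.dualValue y ≤ (1 - ε / 2) * μ}

end PackingSystem

/-! ### t-perfect graphs -/

section Graph

variable {V : Type*}

/-- The odd cycles of `G`, as subgraphs. -/
def OddCycle (G : SimpleGraph V) : Type _ :=
  {H : G.Subgraph // ∃ (u : V) (w : G.Walk u u), w.IsCycle ∧ Odd w.length ∧ w.toSubgraph = H}

/-- The index set of the edge and odd-cycle inequalities. -/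
abbrev EdgeOrOddCycle (G : SimpleGraph V) : Type _ := G.edgeSet ⊕ OddCycle G

instance [Finite V] (G : SimpleGraph V) : Finite (OddCycle G) :=
  inferInstanceAs (Finite {H : G.Subgraph //
    ∃ (u : V) (w : G.Walk u u), w.IsCycle ∧ Odd w.length ∧ w.toSubgraph = H})

instance [Finite V] (G : SimpleGraph V) : Fintype (EdgeOrOddCycle G) :=
  Fintype.ofFinite _

open Classical in
/-- The system `x_u + x_v ≤ 1` for the edges `uv`, and `∑_{u ∈ C} x_u ≤ ⌊|C| / 2⌋` for the odd
cycles `C`. -/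
def stableSystem (G : SimpleGraph V) : PackingSystem (EdgeOrOddCycle G) V where
  A i u := match i with
    | Sum.inl e => if u ∈ (e : Sym2 V) then 1 else 0
    | Sum.inr C => if u ∈ C.1.verts then 1 else 0
  b i := match i with
    | Sum.inl _ => 1
    | Sum.inr C => C.1.verts.ncard / 2

variable [Fintype V]

/-- `G` is t-perfect: for all nonnegative integral weights, the LP relaxation of the edge and
odd-cycle formulation has an integral optimal solution. -/
def IsTPerfect (G : SimpleGraph V) : Prop :=
  ∀ c : V → ℕ, ∃ x : V → ℝ, (stableSystem G).IsLPOptimal c x ∧ ∀ u, x u = 0 ∨ x u = 1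

/-- `S` is a stable set of weight at least `α` times the maximum weight of a stable set. -/
def IsApproxStableSet (G : SimpleGraph V) (α : ℝ) (c : V → ℕ) (S : Finset V) : Prop :=
  G.IsIndepSet (S : Set V) ∧
    ∀ S' : Finset V, G.IsIndepSet (S' : Set V) →
      α * ∑ u ∈ S', (c u : ℝ) ≤ ∑ u ∈ S, (c u : ℝ)

/-! ### The adaptive strategy -/

variable [DecidableEq V]

/-- The elements that have been queried, given the list of the query sets of the earlier
iterations. -/
def queried (h : List (Finset V)) : Finset V := h.foldr (· ∪ ·) ∅

/-- The weights in which the queried elements have their realized values `c` and all other elements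
have the default values `d`. With `d = c⁺` this is the optimistic vector, with `d = c⁻` the
pessimistic one. -/
def revealedWeights (c d : V → ℕ) (h : List (Finset V)) : V → ℕ :=
  fun j => if j ∈ queried h then c j else d j

/-- The random set that contains each `j` independently with probability `x j`. -/
def querySet (x : V → ℝ) (hx : ∀ j, x j ∈ Set.Icc (0 : ℝ) 1) : PMF (Finset V) :=
  PMF.ofFintype
    (fun Q => (∏ j ∈ Q, ENNReal.ofReal (x j)) *
      ∏ j ∈ Finset.univ \ Q, ENNReal.ofReal (1 - x j)) <| by
    rw [← Finset.powerset_univ, ← Finset.prod_add]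
    refine Finset.prod_eq_one fun j _ => ?_
    rw [← ENNReal.ofReal_add (hx j).1 (sub_nonneg.2 (hx j).2), add_sub_cancel,
      ENNReal.ofReal_one]

/-- The choices left open in the adaptive strategy for stable sets: which optimal solution to the
optimistic LP is found in an iteration, and which maximum-weight stable set for the pessimistic
weights is returned in the end. Either choice may depend on everything that is known at that time:
the query sets of the earlier iterations and the current optimistic (or pessimistic) weights, which
include the revealed values. -/
structure AdaptiveStrategy (G : SimpleGraph V) where
  lpSolution : List (Finset V) → (V → ℕ) → V → ℝ
  lpSolution_optimal : ∀ h c, (stableSystem G).IsLPOptimal c (lpSolution h c)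
  finalSet : List (Finset V) → (V → ℕ) → Finset V
  finalSet_optimal : ∀ h c, IsApproxStableSet G 1 c (finalSet h c)

namespace AdaptiveStrategy

variable {G : SimpleGraph V}

/-- The law of the list of query sets (latest first) of the first `t` iterations, when the realized
values are `c`: an iteration takes the optimal solution `x` to the optimistic LP and queries each
`j` with probability `x j`. -/
def queries (s : AdaptiveStrategy G) (cplus c : V → ℕ) : ℕ → PMF (List (Finset V))
  | 0 => PMF.pure []
  | t + 1 => (queries s cplus c t).bind fun h =>
      (querySet (s.lpSolution h (revealedWeights c cplus h))
        (s.lpSolution_optimal h (revealedWeights c cplus h)).1.1).map fun Q => Q :: h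

/-- The law of the output of the strategy with `T` iterations, when the realized values are `c`. -/
def output (s : AdaptiveStrategy G) (cminus cplus c : V → ℕ) (T : ℕ) : PMF (Finset V) :=
  (s.queries cplus c T).map fun h => s.finalSet h (revealedWeights c cminus h)

/-- The probability, over both the random weights `ctilde` (hidden from the strategy) and the random
queries, that the output is an `α`-approximate stable set for the realized weights. -/
def successProb {Ω : Type*} [MeasurableSpace Ω] (Pr : Measure Ω) (s : AdaptiveStrategy G)
    (cminus cplus : V → ℕ) (ctilde : V → Ω → ℕ) (T : ℕ) (α : ℝ) : ENNReal :=
  ∫⁻ ω, (s.output cminus cplus (fun j => ctilde j ω) T).toOuterMeasure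
    {S | IsApproxStableSet G α (fun j => ctilde j ω) S} ∂Pr

end AdaptiveStrategy

end Graph

end StochPack

end

/-! Suppose the returned set weighs less than `(1 - ε) μ`, where `μ ≥ 1` is the realized weight, an
integer, of some stable set. Pessimistic weights are at most the realized ones, so by t-perfectness
the pessimistic LP value is below `(1 - ε) μ`, and LP duality gives a dual vector of value at most
`(1 - ε) μ` that covers the pessimistic weights. The optimistic LP value is still at least `μ`. The
probability of this situation is bounded by a union bound over `μ` and over a finite witness cover
for each `μ`.

A single vector `y` of value at most `(1 - ε / 2) μ` is unlikely to last. Let `Y j` be the amount by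
which `y` covers `j`. The gap `ε μ / 2` between the optimistic LP value and the value of `y` forces
every optimal `x` to put mass at least `ε μ / (2 Δ_c)` on unqueried vertices with `Y j < c⁺ j`
(`Survives.le_sum`). Such a vertex is queried with probability `x j` and then, independently of the
past, has weight `c⁺ j` with probability at least `p`, which falsifies `y` for good. So each
iteration multiplies the survival probability by at most `exp (-p ε μ / (2 Δ_c))`
(`lintegral_survives_succ_le`).

The cover consists of the dual vectors with entries in `θ ℕ`, with `θ` of order `ε²`. Rounding
errors are controlled by a quadratic potential and repaired through constraints with right-hand side
`1` (`exists_rounding`, `IsSparse.exists_discretized`). Only the total deficit matters, so a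
variance bound is enough. There may be exponentially many odd cycles, but only `n ^ O(b)` with
right-hand side `b`, and each unit of such a variable costs `b`; a generating function then bounds
the cover by `n ^ O(μ / θ)` (`IsSparse.finite_and_ncard_le`). For the given `T` the survival bound
beats this count, and the sum over `μ` is at most `ε`. -/

namespace StochPack

/-! ### Rounding dual vectors -/

namespace PackingSystem

variable {ι V : Type*} [Fintype ι]

/-- A fractional dual vector can be rounded, one coordinate at a time, to multiples of `θ`, such
that the dual value plus a quadratic penalty for the change of the covering does not grow much. -/
theorem exists_rounding (P : PackingSystem ι V) (hA : ∀ i j, P.A i j ≤ 1) (y : ι → ℝ)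
    (hy : ∀ i, 0 ≤ y i) {θ l : ℝ} (hθ : 0 < θ) (hl : 0 ≤ l) (J : Finset V) (S : Finset ι) :
    ∃ y' : ι → ℝ, (∀ i ∉ S, y' i = y i) ∧ (∀ i ∈ S, ∃ k : ℕ, y' i = θ * k) ∧
      P.dualValue y' + l * ∑ j ∈ J, (∑ i, y i * (P.A i j : ℝ) - ∑ i, y' i * (P.A i j : ℝ)) ^ 2 ≤
        P.dualValue y + ∑ i ∈ S, l * θ * (y i * ∑ j ∈ J, (P.A i j : ℝ)) := by
  classical
  induction S using Finset.induction_on with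
  | empty => exact ⟨y, by simp, by simp, by simp⟩
  | insert i S hi ih =>
    obtain ⟨y', h1, h2, h3⟩ := ih
    set m : V → ℝ := fun j => ∑ i, y i * (P.A i j : ℝ) with hm
    set Y : V → ℝ := fun j => ∑ i, y' i * (P.A i j : ℝ) with hY
    set B : ℝ := P.b i - 2 * l * ∑ j ∈ J, (P.A i j : ℝ) * (m j - Y j) with hB
    set d : ℝ := l * ∑ j ∈ J, (P.A i j : ℝ) with hd
    have hd0 : 0 ≤ d := mul_nonneg hl (Finset.sum_nonneg fun _ _ => Nat.cast_nonneg _)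
    -- In the change `δ` of one coordinate the potential is quadratic; its leading coefficient is
    -- `d` because the entries are 0 or 1.
    have key : ∀ δ : ℝ, P.dualValue (y' + Pi.single i δ) +
        l * ∑ j ∈ J, (m j - ∑ k, (y' + Pi.single i δ : ι → ℝ) k * (P.A k j : ℝ)) ^ 2 =
        P.dualValue y' + l * ∑ j ∈ J, (m j - Y j) ^ 2 + (B * δ + d * δ ^ 2) := by
      intro δ
      have e1 : P.dualValue (y' + Pi.single i δ) = P.dualValue y' + δ * P.b i := by
        simp [dualValue, add_mul, Finset.sum_add_distrib, Pi.single_apply]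
      have e2 : ∀ j, ∑ k, (y' + Pi.single i δ : ι → ℝ) k * (P.A k j : ℝ) = Y j + δ * P.A i j := by
        intro j
        simp [hY, add_mul, Finset.sum_add_distrib, Pi.single_apply]
      have e3 : ∀ j, (m j - (Y j + δ * P.A i j)) ^ 2 =
          (m j - Y j) ^ 2 - 2 * δ * (P.A i j * (m j - Y j)) + δ ^ 2 * P.A i j := by
        intro j
        have : (P.A i j : ℝ) ^ 2 = P.A i j := by
          have := hA i j
          interval_cases P.A i j <;> norm_num
        linear_combination δ ^ 2 * this
      simp only [e1, e2, e3, Finset.sum_add_distrib, Finset.sum_sub_distrib, ← Finset.mul_sum, hB,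
        hd]
      ring
    set f : ℝ := y i / θ - ⌊y i / θ⌋₊ with hf
    have hq : 0 ≤ y i / θ := div_nonneg (hy i) hθ.le
    have hf0 : 0 ≤ f := sub_nonneg.2 (Nat.floor_le hq)
    have hf1 : f ≤ 1 := by linarith [Nat.lt_floor_add_one (y i / θ)]
    have hyi : y i = θ * (⌊y i / θ⌋₊ + f) := by rw [hf]; field_simp; ring
    have hfy : θ * f ≤ y i := by
      have : 0 ≤ θ * (⌊y i / θ⌋₊ : ℝ) := by positivity
      linarith [hyi]
    -- The candidates are rounding down, `δ = -θ f`, and rounding up, `δ = θ (1 - f)`. With weights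
    -- `1 - f` and `f` they average to zero, which cancels the linear term, and the quadratic term
    -- averages to `d θ² f (1 - f) ≤ d θ y i`. Hence one of the two is good enough.
    have hstep : ∃ δ : ℝ, (∃ k : ℕ, y i + δ = θ * k) ∧ B * δ + d * δ ^ 2 ≤ d * θ * y i := by
      have hbound : d * θ * (θ * f) ≤ d * θ * y i :=
        mul_le_mul_of_nonneg_left hfy (mul_nonneg hd0 hθ.le)
      by_contra hcon
      push Not at hcon
      have c1 := hcon (-(θ * f)) ⟨⌊y i / θ⌋₊, by linear_combination hyi⟩
      have c2 := hcon (θ * (1 - f)) ⟨⌊y i / θ⌋₊ + 1, by push_cast; linear_combination hyi⟩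
      have c1' := lt_of_le_of_lt hbound c1
      have c2' := lt_of_le_of_lt hbound c2
      have e : (1 - f) * (B * (-(θ * f)) + d * (-(θ * f)) ^ 2) +
          f * (B * (θ * (1 - f)) + d * (θ * (1 - f)) ^ 2) =
          d * θ * (θ * f) - d * (θ * f) ^ 2 := by ring
      have hnn : 0 ≤ d * (θ * f) ^ 2 := by positivity
      rcases hf0.eq_or_lt with h0 | h0
      · rw [← h0] at c1'; simp at c1'
      · have p1 := mul_le_mul_of_nonneg_left c1'.le (sub_nonneg.2 hf1)
        have p2 := mul_lt_mul_of_pos_left c2' h0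
        nlinarith
    obtain ⟨δ, hk, hδ⟩ := hstep
    refine ⟨y' + Pi.single i δ, fun k hk' => ?_, fun k hk' => ?_, ?_⟩
    · rw [Finset.mem_insert, not_or] at hk'
      simp [hk'.1, h1 k hk'.2]
    · rcases Finset.mem_insert.1 hk' with rfl | hkS
      · simpa [h1 k hi] using hk
      · have : k ≠ i := fun h => hi (h ▸ hkS)
        simpa [this] using h2 k hkS
    · rw [key, Finset.sum_insert hi]
      have : l * θ * (y i * ∑ j ∈ J, (P.A i j : ℝ)) = d * θ * y i := by rw [hd]; ring
      rw [this]
      linarith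

/-! ### LP duality with box constraints -/

variable [Fintype V]

/-- The packing system `P` together with the constraints `x_j ≤ 1`. -/
def boxed [DecidableEq V] (P : PackingSystem ι V) : PackingSystem (ι ⊕ V) V where
  A i j := Sum.elim (fun i => P.A i j) (fun k => if k = j then 1 else 0) i
  b := Sum.elim P.b fun _ => 1

/-- Weak form of strong duality: if the LP value is below `β`, then the dual of the system with the
box constraints has a solution of value at most `β`. -/
theorem exists_dual_of_forall_lt [DecidableEq V] (P : PackingSystem ι V) (c : V → ℕ) (β : ℝ)
    (h : ∀ x ∈ P.relaxation, ∑ j, (c j : ℝ) * x j < β) :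
    ∃ y : ι ⊕ V → ℝ, (∀ i, 0 ≤ y i) ∧ P.boxed.dualValue y ≤ β ∧ P.boxed.DualCovers c y := by
  by_contra hno
  push Not at hno
  have le_of_perturb : ∀ X Y M : ℝ, (∀ δ : ℝ, 0 < δ → X + δ * Y < M) → X ≤ M := by
    intro X Y M hδ
    by_contra hlt
    push Not at hlt
    have hY : 0 < |Y| + 1 := by positivity
    have h1 := hδ ((X - M) / (|Y| + 1)) (div_pos (by linarith) hY)
    have h2 : (X - M) / (|Y| + 1) * -Y ≤ X - M := by
      rw [div_mul_eq_mul_div, div_le_iff₀ hY]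
      exact mul_le_mul_of_nonneg_left (by linarith [neg_abs_le Y]) (by linarith)
    linarith
  have nonpos_of_mul_le : ∀ X M : ℝ, (∀ t : ℝ, 0 ≤ t → t * X ≤ M) → X ≤ 0 := by
    intro X M ht
    by_contra hX
    push Not at hX
    have h1 := ht ((|M| + 1) / X) (by positivity)
    rw [div_mul_cancel₀ _ hX.ne'] at h1
    linarith [le_abs_self M]
  -- Strict inequalities make `D` open, so `(c, β)` can be separated from it without any closedness
  -- argument. The separating functional `(a, ρ)` yields the primal solution `a / (-ρ)`.
  set D : Set ((V → ℝ) × ℝ) := {d | ∃ y : ι ⊕ V → ℝ, (∀ i, 0 ≤ y i) ∧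
    (∀ j, d.1 j < ∑ i, y i * (P.boxed.A i j : ℝ)) ∧ P.boxed.dualValue y < d.2} with hD
  have hDopen : IsOpen D := by
    have : D = ⋃ y : {y : ι ⊕ V → ℝ // ∀ i, 0 ≤ y i},
        ((⋂ j, {d : (V → ℝ) × ℝ | d.1 j < ∑ i, y.1 i * (P.boxed.A i j : ℝ)}) ∩
          {d | P.boxed.dualValue y.1 < d.2}) := by
      ext d
      simp only [hD, Set.mem_ofPred_eq, Set.mem_iUnion, Set.mem_inter_iff, Set.mem_iInter,
        Subtype.exists, exists_prop]
    rw [this]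
    refine isOpen_iUnion fun y => IsOpen.inter (isOpen_iInter_of_finite fun j => ?_) ?_
    · exact isOpen_lt (by fun_prop) (by fun_prop)
    · exact isOpen_lt (by fun_prop) (by fun_prop)
  have hDconv : Convex ℝ D := by
    rintro d ⟨y, hy0, hy1, hy2⟩ d' ⟨y', hy0', hy1', hy2'⟩ s t hs ht hst
    have lt_of : ∀ u v u' v' : ℝ, u < v → u' < v' → s * u + t * u' < s * v + t * v' := by
      intro u v u' v' hu hu'
      rcases hs.eq_or_lt with rfl | hs'
      · have : t = 1 := by linarith
        subst this; linarith
      · have := mul_lt_mul_of_pos_left hu hs'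
        have := mul_le_mul_of_nonneg_left hu'.le ht
        linarith
    refine ⟨fun i => s * y i + t * y' i, fun i => ?_, fun j => ?_, ?_⟩
    · have := hy0 i; have := hy0' i; positivity
    · have := lt_of _ _ _ _ (hy1 j) (hy1' j)
      simp only [Prod.fst_add, Prod.smul_fst, Pi.add_apply, Pi.smul_apply, smul_eq_mul]
      refine this.trans_eq ?_
      simp only [Finset.mul_sum, ← Finset.sum_add_distrib]
      exact Finset.sum_congr rfl fun i _ => by ring
    · have := lt_of _ _ _ _ hy2 hy2'
      simp only [Prod.snd_add, Prod.smul_snd, smul_eq_mul]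
      refine lt_of_eq_of_lt ?_ this
      simp only [dualValue, Finset.mul_sum, ← Finset.sum_add_distrib]
      exact Finset.sum_congr rfl fun i _ => by ring
  have hnot : ((fun j => (c j : ℝ), β) : (V → ℝ) × ℝ) ∉ D := by
    rintro ⟨y, hy0, hy1, hy2⟩
    exact hno y hy0 hy2.le fun j => (hy1 j).le
  obtain ⟨f, hf⟩ := geometric_hahn_banach_open_point hDconv hDopen hnot
  set a : V → ℝ := fun j => f (Pi.single j 1, 0) with ha
  set ρ : ℝ := f (0, 1) with hρ
  have hfe : ∀ (u : V → ℝ) (r : ℝ), f (u, r) = ∑ j, u j * a j + r * ρ := by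
    intro u r
    have : ((u, r) : (V → ℝ) × ℝ) =
        ∑ j, u j • ((Pi.single j 1, 0) : (V → ℝ) × ℝ) + r • ((0, 1) : (V → ℝ) × ℝ) := by
      refine Prod.ext ?_ ?_
      · simp only [Prod.fst_add, Prod.fst_sum, Prod.smul_fst, smul_zero, add_zero]
        ext j
        simp [Finset.sum_apply, Pi.single_apply]
      · simp [Prod.snd_sum]
    rw [this, map_add, map_sum, map_smul]
    simp only [map_smul, smul_eq_mul, ha, hρ]
  set M := f (fun j => (c j : ℝ), β) with hM
  -- A perturbation by `δ` extends the separation to the weak inequalities.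
  have hle : ∀ (y : ι ⊕ V → ℝ) (u : V → ℝ) (r : ℝ), (∀ i, 0 ≤ y i) →
      (∀ j, u j ≤ ∑ i, y i * (P.boxed.A i j : ℝ)) → P.boxed.dualValue y ≤ r →
      ∑ j, u j * a j + r * ρ ≤ M := by
    intro y u r hy hu hr
    refine le_of_perturb _ (ρ - ∑ j, a j) M fun δ hδ => ?_
    have h1 := hf (fun j => u j - δ, r + δ)
      ⟨y, hy, fun j => (sub_lt_self _ hδ).trans_le (hu j), hr.trans_lt (lt_add_of_pos_right _ hδ)⟩
    rw [hfe] at h1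
    refine lt_of_eq_of_lt ?_ h1
    simp only [sub_mul, Finset.sum_sub_distrib, ← Finset.mul_sum]
    ring
  have ha0 : ∀ j, 0 ≤ a j := by
    intro j
    refine neg_nonpos.1 (nonpos_of_mul_le _ M fun t ht => ?_)
    have := hle 0 (Pi.single j (-t)) 0 (by simp) (fun k => ?_) (by simp [dualValue])
    · simpa [Pi.single_apply] using this
    · by_cases hk : k = j
      · subst hk; simpa using ht
      · simp [hk]
  have hρ0 : ρ ≤ 0 := nonpos_of_mul_le _ M fun t ht => by
    simpa using hle 0 0 t (by simp) (by simp) (by simpa [dualValue] using ht)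
  have hrow : ∀ i, ∑ j, (P.boxed.A i j : ℝ) * a j + P.boxed.b i * ρ ≤ 0 := by
    classical
    intro i
    refine nonpos_of_mul_le _ M fun t ht => ?_
    have := hle (Pi.single i t) (fun j => t * P.boxed.A i j) (t * P.boxed.b i) (fun k => ?_)
      (fun j => by simp [Pi.single_apply]) (by simp [dualValue, Pi.single_apply])
    · refine le_of_eq_of_le ?_ this
      simp only [mul_add, Finset.mul_sum, mul_assoc]
    · by_cases hk : k = i
      · subst hk; simpa using ht
      · simp [hk]
  have hbox : ∀ j, a j + ρ ≤ 0 := by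
    intro j
    simpa [boxed] using hrow (Sum.inr j)
  -- The box rows give `a j ≤ -ρ`, so `ρ = 0` would make the functional vanish, contrary to strict
  -- separation.
  have hρneg : ρ < 0 := by
    refine lt_of_le_of_ne hρ0 fun h0 => ?_
    have haz : ∀ j, a j = 0 := fun j => le_antisymm (by linarith [hbox j]) (ha0 j)
    have := hf (fun _ => -1, 1) ⟨0, by simp, by simp, by simp [dualValue]⟩
    rw [hM, hfe, hfe] at this
    simp [haz, h0] at this
  have hM0 : 0 ≤ M := by simpa using hle 0 0 0 (by simp) (by simp) (by simp [dualValue])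
  have hρ' : 0 < -ρ := by linarith
  have hfeas : (fun j => a j / -ρ) ∈ P.relaxation := by
    refine ⟨fun j => ⟨div_nonneg (ha0 j) hρ'.le, ?_⟩, fun i => ?_⟩
    · rw [div_le_one hρ']; linarith [hbox j]
    · have := hrow (Sum.inl i)
      simp only [boxed, Sum.elim_inl] at this
      simp only [mul_div_assoc']
      rw [← Finset.sum_div, div_le_iff₀ hρ']
      linarith
  have h1 := h _ hfeas
  simp only [mul_div_assoc'] at h1
  rw [← Finset.sum_div, div_lt_iff₀ hρ'] at h1
  rw [hM, hfe] at hM0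
  linarith

/-! ### Witness covers of sparse systems -/

/-- The properties of packing systems that are used for the construction of witness covers: the
matrix is a 0/1 matrix, each row has at most `3 b_i` ones, each covered element is in a constraint
with right-hand side `1`, and there are not too many constraints with a given right-hand side. -/
structure IsSparse (P : PackingSystem ι V) (n : ℕ) : Prop where
  A_le_one : ∀ i j, P.A i j ≤ 1
  b_pos : ∀ i, 1 ≤ P.b i
  sum_A_le : ∀ i, ∑ j, P.A i j ≤ 3 * P.b i
  exists_unit : ∀ i j, P.A i j ≠ 0 → ∃ i', P.A i' j = 1 ∧ P.b i' = 1
  sum_inv_pow_le : ∑ i, ((n : ℝ)⁻¹) ^ (9 * P.b i) ≤ 1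

/-- After rounding with penalty factor `1 / (2 s)`, where `s = ε / 12`, AM-GM bounds each deficit by
its penalty plus `s / 2`. Raising a unit constraint through each deficient element therefore costs
no more than the penalty already paid for, plus `s / 2 + θ` per element. -/
theorem IsSparse.exists_discretized {P : PackingSystem ι V} {n : ℕ} (hP : P.IsSparse n)
    {ε θ μ : ℝ} (hε : 0 < ε) (hε1 : ε < 1) (hθ : 0 < θ) (hθε : θ ≤ (ε / 12) ^ 2) (hμ : 1 ≤ μ)
    {c : V → ℕ} {y : ι → ℝ} (hy : ∀ i, 0 ≤ y i) (hval : P.dualValue y ≤ (1 - ε) * μ)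
    (hcov : P.DualCovers c y) : ∃ y' ∈ P.discretizedDuals θ ε μ, P.DualCovers c y' := by
  classical
  set s : ℝ := ε / 12 with hs
  have hs0 : 0 < s := by positivity
  -- Integral weights are at least 1 on their support `J`, so `y` covers each element of `J` at
  -- least once; this gives `J.card ≤ 3 * P.dualValue y`.
  set J : Finset V := Finset.univ.filter fun j => c j ≠ 0 with hJ
  obtain ⟨y', -, h2, h3⟩ := exists_rounding P hP.A_le_one y hy hθ
    (l := 1 / (2 * s)) (by positivity) J Finset.univ
  choose k hk using fun i => h2 i (Finset.mem_univ i)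
  set m : V → ℝ := fun j => ∑ i, y i * (P.A i j : ℝ) with hm
  set Y : V → ℝ := fun j => ∑ i, y' i * (P.A i j : ℝ) with hY
  have hm1 : ∀ j ∈ J, 1 ≤ m j := by
    intro j hj
    have hcj : c j ≠ 0 := by simpa [hJ] using hj
    have : (1 : ℝ) ≤ c j := by exact_mod_cast Nat.one_le_iff_ne_zero.2 hcj
    exact this.trans (hcov j)
  have hunit : ∀ j : J, ∃ i, P.A i j = 1 ∧ P.b i = 1 := by
    intro j
    have : ∃ i, P.A i j ≠ 0 := by
      by_contra! hno
      have := hm1 j j.2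
      simp only [hm, hno, Nat.cast_zero, mul_zero, Finset.sum_const_zero] at this
      linarith
    obtain ⟨i, hi⟩ := this
    exact hP.exists_unit i j hi
  choose r hr using hunit
  -- The number of multiples of `θ` needed to repair the deficit at `j`; the natural-number ceiling
  -- is 0 if there is no deficit.
  set q : J → ℕ := fun j => ⌈((c j : ℝ) - Y j) / θ⌉₊ with hq
  set y'' : ι → ℝ := fun i => y' i + ∑ j : J, if r j = i then θ * (q j : ℝ) else 0 with hy''
  have hqub : ∀ j : J, θ * (q j : ℝ) ≤ 1 / (2 * s) * (m j - Y j) ^ 2 + s / 2 + θ := by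
    intro j
    have hamgm : m j - Y j ≤ 1 / (2 * s) * (m j - Y j) ^ 2 + s / 2 := by
      rw [← sub_nonneg]
      have : 1 / (2 * s) * (m j - Y j) ^ 2 + s / 2 - (m j - Y j) =
          1 / (2 * s) * (m j - Y j - s) ^ 2 := by
        field_simp
        ring
      rw [this]
      positivity
    by_cases hneg : ((c j : ℝ) - Y j) / θ ≤ 0
    · have : q j = 0 := Nat.ceil_eq_zero.2 hneg
      rw [this]
      have : 0 ≤ 1 / (2 * s) * (m j - Y j) ^ 2 + s / 2 + θ := by positivity
      simpa using this
    · have h1 : (q j : ℝ) ≤ ((c j : ℝ) - Y j) / θ + 1 :=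
        (Nat.ceil_lt_add_one (not_le.1 hneg).le).le
      have h2 : θ * (q j : ℝ) ≤ (c j : ℝ) - Y j + θ := by
        calc θ * (q j : ℝ) ≤ θ * (((c j : ℝ) - Y j) / θ + 1) :=
              mul_le_mul_of_nonneg_left h1 hθ.le
          _ = _ := by field_simp
      have h4 : (c j : ℝ) ≤ m j := hcov j
      linarith
  have hD0 : 0 ≤ P.dualValue y :=
    Finset.sum_nonneg fun i _ => mul_nonneg (hy i) (Nat.cast_nonneg _)
  have hsumA : ∀ i, ∑ j ∈ J, (P.A i j : ℝ) ≤ 3 * P.b i := by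
    intro i
    refine (Finset.sum_le_sum_of_subset_of_nonneg (Finset.subset_univ J)
      fun _ _ _ => Nat.cast_nonneg _).trans ?_
    exact_mod_cast hP.sum_A_le i
  have hyA : ∑ i, y i * ∑ j ∈ J, (P.A i j : ℝ) ≤ 3 * P.dualValue y := by
    rw [dualValue, Finset.mul_sum]
    refine Finset.sum_le_sum fun i _ => ?_
    linarith [mul_le_mul_of_nonneg_left (hsumA i) (hy i)]
  have hJcard : (J.card : ℝ) ≤ 3 * P.dualValue y := by
    refine le_trans ?_ hyA
    calc (J.card : ℝ) = ∑ j ∈ J, 1 := by simp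
      _ ≤ ∑ j ∈ J, m j := Finset.sum_le_sum hm1
      _ = _ := by
        simp only [hm, Finset.mul_sum]
        exact Finset.sum_comm
  have hval'' : P.dualValue y'' = P.dualValue y' + ∑ j : J, θ * (q j : ℝ) := by
    simp only [dualValue, hy'', add_mul, Finset.sum_add_distrib, Finset.sum_mul]
    rw [Finset.sum_comm]
    simp [ite_mul, (hr _).2]
  refine ⟨y'', ⟨⟨fun i => k i + ∑ j : J, if r j = i then q j else 0, fun i => ?_⟩, ?_⟩,
    fun j => ?_⟩
  · simp only [hy'', hk]
    push_cast
    rw [mul_add, Finset.mul_sum]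
    simp
  · have hqsum : ∑ j : J, θ * (q j : ℝ) ≤
        1 / (2 * s) * ∑ j ∈ J, (m j - Y j) ^ 2 + J.card * (s / 2 + θ) := by
      rw [Finset.mul_sum, ← Finset.sum_coe_sort J]
      calc ∑ j : J, θ * (q j : ℝ) ≤ ∑ j : J, (1 / (2 * s) * (m j - Y j) ^ 2 + (s / 2 + θ)) :=
            Finset.sum_le_sum fun j _ => by linarith [hqub j]
        _ = _ := by
          rw [Finset.sum_add_distrib, Finset.sum_const, Finset.card_univ, Fintype.card_coe,
            nsmul_eq_mul]
    rw [← Finset.mul_sum] at h3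
    -- This is the place that needs `θ ≤ s²`.
    have hlθ : 1 / (2 * s) * θ ≤ s / 2 := by
      rw [one_div, inv_mul_le_iff₀ (by positivity)]
      linarith [sq s]
    have t1 : 1 / (2 * s) * θ * ∑ i, y i * ∑ j ∈ J, (P.A i j : ℝ) ≤
        s / 2 * (3 * P.dualValue y) := by
      refine (mul_le_mul_of_nonneg_left hyA (by positivity)).trans ?_
      exact mul_le_mul_of_nonneg_right hlθ (by positivity)
    have t2 : (J.card : ℝ) * (s / 2 + θ) ≤ 3 * P.dualValue y * (s / 2 + θ) :=
      mul_le_mul_of_nonneg_right hJcard (by positivity)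
    have hDμ : P.dualValue y ≤ μ := hval.trans (by nlinarith)
    -- Rounding and repair together cost at most `3 (s + θ)` times the old value, and `3 (s + s /
    -- 12) = 13 ε / 48 ≤ ε / 2`.
    have hθs : θ ≤ s / 12 := hθε.trans (by nlinarith)
    have t3 : 3 * (s + θ) * P.dualValue y ≤ ε / 2 * μ := by
      refine mul_le_mul ?_ hDμ hD0 (by positivity)
      linarith
    rw [hval'']
    linarith
  · by_cases hj : j ∈ J
    · have hA1 : (P.A (r ⟨j, hj⟩) j : ℝ) = 1 := by exact_mod_cast (hr ⟨j, hj⟩).1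
      have h1 : (c j : ℝ) - Y j ≤ θ * (q ⟨j, hj⟩ : ℝ) := by
        have := Nat.le_ceil (((c j : ℝ) - Y j) / θ)
        rw [div_le_iff₀ hθ] at this
        linarith
      have h2 : ∑ i, y'' i * (P.A i j : ℝ) = Y j +
          ∑ i, (∑ j' : J, if r j' = i then θ * (q j' : ℝ) else 0) * (P.A i j : ℝ) := by
        simp only [hy'', hY, add_mul, Finset.sum_add_distrib]
      have h4 : ∀ i, 0 ≤ ∑ j' : J, if r j' = i then θ * (q j' : ℝ) else 0 := fun i =>
        Finset.sum_nonneg fun j' _ => by split_ifs <;> positivity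
      have h5 := Finset.single_le_sum
        (f := fun i => (∑ j' : J, if r j' = i then θ * (q j' : ℝ) else 0) * (P.A i j : ℝ))
        (fun i _ => mul_nonneg (h4 i) (Nat.cast_nonneg _)) (Finset.mem_univ (r ⟨j, hj⟩))
      have h6 := Finset.single_le_sum
        (f := fun j' : J => if r j' = r ⟨j, hj⟩ then θ * (q j' : ℝ) else 0)
        (fun j' _ => by split_ifs <;> positivity) (Finset.mem_univ ⟨j, hj⟩)
      simp only [hA1, mul_one, if_true] at h5 h6
      rw [h2]
      linarith
    · have : c j = 0 := by simpa [hJ] using hj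
      rw [this, Nat.cast_zero]
      refine Finset.sum_nonneg fun i _ => mul_nonneg (add_nonneg ?_ ?_) (Nat.cast_nonneg _)
      · rw [hk]; positivity
      · exact Finset.sum_nonneg fun j' _ => by split_ifs <;> positivity

theorem geom_sum_le_one_add {w : ℝ} (hw : 0 ≤ w) (hw2 : w ≤ 1 / 2) (M : ℕ) :
    ∑ k ∈ Finset.range M, w ^ k ≤ 1 + 2 * w := by
  induction M with
  | zero => simp; linarith
  | succ M ih =>
    rw [Finset.sum_range_succ']
    simp only [pow_succ', ← Finset.mul_sum, pow_zero]
    nlinarith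

/-- Give the multiplicity vector `k` the weight `∏ i, w i ^ k i` with `w i = n ^ (-9 b i)`. Each
vector within the budget has weight at least `n ^ (-9 μ / θ)`, while the total weight is at most the
product of the geometric series, hence at most `exp (2 ∑ i, w i) ≤ exp 2`. -/
theorem IsSparse.finite_and_ncard_le {P : PackingSystem ι V} {n : ℕ} (hP : P.IsSparse n)
    (hn : 2 ≤ n) {ε θ μ : ℝ} (hε : 0 < ε) (hθ : 0 < θ) (hμ : 1 ≤ μ) :
    (P.discretizedDuals θ ε μ).Finite ∧
      ((P.discretizedDuals θ ε μ).ncard : ℝ) ≤ Real.exp (9 * (μ / θ) * Real.log n + 2) := by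
  classical
  set M := ⌊μ / θ⌋₊ with hM
  set F : Finset (ι → ℕ) := (Fintype.piFinset fun _ => Finset.range (M + 1)).filter
    fun k => ∑ i, (k i : ℝ) * P.b i ≤ μ / θ with hF
  have hn0 : (0 : ℝ) < n := by positivity
  have hlog : 0 < Real.log n := Real.log_pos (by exact_mod_cast hn)
  have hsub : P.discretizedDuals θ ε μ ⊆
      ((F.image fun k i => θ * (k i : ℝ) : Finset (ι → ℝ)) : Set (ι → ℝ)) := by
    rintro y ⟨⟨k, hk⟩, hy⟩
    have hsum : ∑ i, (k i : ℝ) * P.b i ≤ μ / θ := by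
      rw [le_div_iff₀ hθ]
      calc (∑ i, (k i : ℝ) * P.b i) * θ = P.dualValue y := by
            simp only [dualValue, hk, Finset.sum_mul]
            exact Finset.sum_congr rfl fun i _ => by ring
        _ ≤ (1 - ε / 2) * μ := hy
        _ ≤ μ := by nlinarith
    simp only [Finset.coe_image, Set.mem_image, Finset.mem_coe]
    refine ⟨k, ?_, (funext hk).symm⟩
    simp only [hF, Finset.mem_filter, Fintype.mem_piFinset, Finset.mem_range, Nat.lt_succ_iff]
    refine ⟨fun i => Nat.le_floor (le_trans ?_ hsum), hsum⟩
    refine le_trans ?_ (Finset.single_le_sum (f := fun i => (k i : ℝ) * P.b i)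
      (fun i _ => by positivity) (Finset.mem_univ i))
    exact le_mul_of_one_le_right (Nat.cast_nonneg _) (by exact_mod_cast hP.b_pos i)
  refine ⟨(Finset.finite_toSet _).subset hsub, ?_⟩
  have hcard : (P.discretizedDuals θ ε μ).ncard ≤ F.card := by
    refine (Set.ncard_le_ncard hsub (Finset.finite_toSet _)).trans ?_
    rw [Set.ncard_coe_finset]
    exact Finset.card_image_le
  set w : ι → ℝ := fun i => ((n : ℝ)⁻¹) ^ (9 * P.b i) with hw
  have hw0 : ∀ i, 0 ≤ w i := fun i => by positivity
  have hn2 : (n : ℝ)⁻¹ ≤ 1 / 2 := by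
    rw [one_div]
    exact inv_anti₀ (by norm_num) (by exact_mod_cast hn)
  have hw2 : ∀ i, w i ≤ 1 / 2 := fun i => by
    refine le_trans ?_ hn2
    exact pow_le_of_le_one (by positivity) (by linarith) (by have := hP.b_pos i; omega)
  have hwpow : ∀ k : ι → ℕ, ∏ i, w i ^ k i =
      Real.exp (-(9 * Real.log n * ∑ i, (k i : ℝ) * P.b i)) := by
    intro k
    rw [Finset.mul_sum, ← Finset.sum_neg_distrib, Real.exp_sum]
    refine Finset.prod_congr rfl fun i _ => ?_
    simp only [hw]
    rw [← Real.exp_log (inv_pos.2 hn0), ← Real.exp_nat_mul, ← Real.exp_nat_mul, Real.log_inv]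
    push_cast
    ring_nf
  calc ((P.discretizedDuals θ ε μ).ncard : ℝ) ≤ ∑ _k ∈ F, 1 := by
        simpa using (by exact_mod_cast hcard)
    _ ≤ ∑ k ∈ F, Real.exp (9 * (μ / θ) * Real.log n) * ∏ i, w i ^ k i := by
        refine Finset.sum_le_sum fun k hk => ?_
        rw [hwpow, ← Real.exp_add]
        refine Real.one_le_exp ?_
        have := (Finset.mem_filter.1 hk).2
        nlinarith
    _ ≤ ∑ k ∈ Fintype.piFinset fun _ => Finset.range (M + 1),
          Real.exp (9 * (μ / θ) * Real.log n) * ∏ i, w i ^ k i :=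
        Finset.sum_le_sum_of_subset_of_nonneg (Finset.filter_subset _ _) fun k _ _ =>
          mul_nonneg (Real.exp_pos _).le (Finset.prod_nonneg fun i _ => pow_nonneg (hw0 i) _)
    _ = Real.exp (9 * (μ / θ) * Real.log n) * ∏ i, ∑ k ∈ Finset.range (M + 1), w i ^ k := by
        rw [← Finset.mul_sum, Finset.prod_univ_sum]
    _ ≤ Real.exp (9 * (μ / θ) * Real.log n) * ∏ i, Real.exp (2 * w i) := by
        refine mul_le_mul_of_nonneg_left ?_ (Real.exp_pos _).le
        refine Finset.prod_le_prod (fun i _ => Finset.sum_nonneg fun k _ => pow_nonneg (hw0 i) _)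
          fun i _ => ?_
        refine (geom_sum_le_one_add (hw0 i) (hw2 i) _).trans ?_
        linarith [Real.add_one_le_exp (2 * w i)]
    _ ≤ Real.exp (9 * (μ / θ) * Real.log n + 2) := by
        rw [← Real.exp_sum, ← Finset.mul_sum, ← Real.exp_add]
        refine Real.exp_le_exp.2 ?_
        have : ∑ i, w i ≤ 1 := hP.sum_inv_pow_le
        linarith

theorem IsSparse.isWitnessCover {P : PackingSystem ι V} {n : ℕ} (hP : P.IsSparse n)
    (hn : 2 ≤ n) {ε θ μ : ℝ} (hε : 0 < ε) (hε1 : ε < 1) (hθ : 0 < θ) (hθε : θ ≤ (ε / 12) ^ 2)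
    (hμ : 1 ≤ μ) : P.IsWitnessCover ε (ε / 2) μ (P.discretizedDuals θ ε μ) := by
  refine ⟨(hP.finite_and_ncard_le hn hε hθ hμ).1, ?_, ?_, fun y hy => hy.2⟩
  · rintro y ⟨⟨k, hk⟩, -⟩ i
    rw [hk]
    positivity
  · intro c hc y hy hval hcov
    obtain ⟨y', hy', hcov'⟩ := hP.exists_discretized hε hε1 hθ hθε hμ hy hval hcov
    exact hc y' hy' hcov'

end PackingSystem

/-- The instance is arbitrary because `EdgeOrOddCycle G` carries `Fintype.ofFinite` and not the sum
instance. -/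
theorem sum_sum_type_of_instance {α β M : Type*} [AddCommMonoid M] [Fintype α] [Fintype β]
    (inst : Fintype (α ⊕ β)) (f : α ⊕ β → M) :
    @Finset.sum _ _ _ (@Finset.univ _ inst) f = ∑ a, f (Sum.inl a) + ∑ b, f (Sum.inr b) := by
  rw [Subsingleton.elim inst (instFintypeSum α β)]
  exact Fintype.sum_sum_type f

/-- The `n` box rows contribute `n · n⁻⁹ ≤ 1 / 2` to the weighted count, so the original rows may
use only the other half. -/
theorem PackingSystem.IsSparse.boxed {ι V : Type*} [Fintype ι] [Fintype V] [DecidableEq V]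
    {P : PackingSystem ι V} (hn : 2 ≤ Fintype.card V) (hP : P.IsSparse (Fintype.card V))
    (hsum : ∑ i, ((Fintype.card V : ℝ)⁻¹) ^ (9 * P.b i) ≤ 1 / 2) :
    P.boxed.IsSparse (Fintype.card V) where
  A_le_one := by
    rintro (i | k) j
    · exact hP.A_le_one i j
    · simp only [PackingSystem.boxed, Sum.elim_inr]
      split_ifs <;> simp
  b_pos := by
    rintro (i | k)
    · exact hP.b_pos i
    · simp [PackingSystem.boxed]
  sum_A_le := by
    rintro (i | k)
    · exact hP.sum_A_le i
    · simp [PackingSystem.boxed]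
  exists_unit i j _ := ⟨Sum.inr j, by simp [PackingSystem.boxed]⟩
  sum_inv_pow_le := by
    rw [Fintype.sum_sum_type]
    have hn' : (2 : ℝ) ≤ Fintype.card V := by exact_mod_cast hn
    have hn0 : (0 : ℝ) < Fintype.card V := by linarith
    have : ∑ j : V, ((Fintype.card V : ℝ)⁻¹) ^ (9 * P.boxed.b (Sum.inr j)) ≤ 1 / 2 := by
      simp only [PackingSystem.boxed, Sum.elim_inr, mul_one, Finset.sum_const, Finset.card_univ,
        nsmul_eq_mul]
      rw [pow_succ', ← mul_assoc, mul_inv_cancel₀ hn0.ne', one_mul, inv_pow, one_div]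
      refine inv_anti₀ (by norm_num) (hn'.trans ?_)
      exact le_self_pow₀ (by linarith) (by norm_num)
    simp only [PackingSystem.boxed, Sum.elim_inl] at this ⊢
    linarith

/-! ### Odd cycles as closed walks -/

section Walks

variable {V : Type*} {G : SimpleGraph V}

theorem toSubgraph_eq_of_support_eq {u v u' v' : V} (w : G.Walk u v) (w' : G.Walk u' v')
    (h : w.support = w'.support) : w.toSubgraph = w'.toSubgraph := by
  have hu : u = u' := by
    have := congrArg List.head? h
    rwa [← w.cons_tail_support, ← w'.cons_tail_support, List.head?_cons, List.head?_cons,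
      Option.some.injEq] at this
  have hv : v = v' := by
    have := w.getLast_support
    simp only [h, w'.getLast_support] at this
    exact this.symm
  subst hu hv
  rw [SimpleGraph.Walk.ext_support h]

theorem IsCycle.mem_verts_iff {u v : V} {w : G.Walk u u} (hw : w.IsCycle) :
    v ∈ w.toSubgraph.verts ↔ v ∈ w.support.tail := by
  rw [SimpleGraph.Walk.mem_verts_toSubgraph]
  refine ⟨fun h => ?_, List.mem_of_mem_tail⟩
  rw [← w.cons_tail_support, List.mem_cons] at h
  rcases h with rfl | h
  · exact SimpleGraph.Walk.end_mem_tail_support hw.not_nil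
  · exact h

theorem IsCycle.ncard_verts {u : V} {w : G.Walk u u} (hw : w.IsCycle) :
    w.toSubgraph.verts.ncard = w.length := by
  classical
  have : w.toSubgraph.verts = (w.support.tail.toFinset : Set V) := by
    ext v
    rw [IsCycle.mem_verts_iff hw, Finset.mem_coe, List.mem_toFinset]
  rw [this, Set.ncard_coe_finset, List.toFinset_card_of_nodup hw.support_nodup, List.length_tail,
    w.length_support, Nat.add_sub_cancel]

theorem sum_support_tail_eq_sum_support_dropLast {u : V} (w : G.Walk u u) (f : V → ℕ) :
    (w.support.tail.map f).sum = (w.support.dropLast.map f).sum := by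
  have h1 : (w.support.map f).sum = f u + (w.support.tail.map f).sum := by
    conv_lhs => rw [← w.cons_tail_support]
    rw [List.map_cons, List.sum_cons]
  have h2 : (w.support.map f).sum = (w.support.dropLast.map f).sum + f u := by
    conv_lhs => rw [← w.map_fst_darts_append]
    rw [w.map_fst_darts, List.map_append, List.sum_append, List.map_singleton, List.sum_singleton]
  omega

/-- Summing `f` over both ends of all darts of a closed walk counts every visit twice, and each dart
contributes at most 1. For the indicator of a stable set this is the odd-cycle inequality before
rounding down. -/
theorem two_mul_sum_support_tail_le {u : V} (w : G.Walk u u) (f : V → ℕ)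
    (hf : ∀ a b, G.Adj a b → f a + f b ≤ 1) : 2 * (w.support.tail.map f).sum ≤ w.length := by
  have h1 : ∀ l : List G.Dart,
      ((l.map fun d => d.fst).map f).sum + ((l.map fun d => d.snd).map f).sum ≤ l.length := by
    intro l
    induction l with
    | nil => simp
    | cons d l ih =>
      have := hf _ _ d.adj
      simp only [List.map_cons, List.sum_cons, List.length_cons]
      omega
  have := h1 w.darts
  rw [w.map_fst_darts, w.map_snd_darts, w.length_darts,
    ← sum_support_tail_eq_sum_support_dropLast] at this
  omega

end Walks

/-! ### The stable set system: sparsity and t-perfectness -/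

section Graph

variable {V : Type*} {G : SimpleGraph V}

theorem OddCycle.three_le_ncard (C : OddCycle G) : 3 ≤ C.1.verts.ncard ∧ Odd C.1.verts.ncard := by
  obtain ⟨H, u, w, hw, hodd, rfl⟩ := C
  rw [IsCycle.ncard_verts hw]
  exact ⟨hw.three_le_length, hodd⟩

theorem OddCycle.exists_support (C : OddCycle G) : ∃ l : List.Vector V (C.1.verts.ncard + 1),
    ∃ (u : V) (w : G.Walk u u), w.support = l.1 ∧ w.toSubgraph = C.1 := by
  obtain ⟨H, u, w, hw, hodd, rfl⟩ := C
  exact ⟨⟨w.support, by rw [w.length_support, IsCycle.ncard_verts hw]⟩, u, w, rfl, rfl⟩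

theorem OddCycle.exists_adj (C : OddCycle G) {u : V} (hu : u ∈ C.1.verts) :
    ∃ v, G.Adj u v := by
  obtain ⟨H, x, w, hw, hodd, rfl⟩ := C
  rw [SimpleGraph.Walk.mem_verts_toSubgraph,
    SimpleGraph.Walk.mem_support_iff_exists_mem_edges_of_not_nil hw.not_nil] at hu
  obtain ⟨e, he, hue⟩ := hu
  obtain ⟨v, rfl⟩ := hue
  exact ⟨v, w.edges_subset_edgeSet he⟩

variable [Fintype V]

/-- A cycle of length `m` is determined by the support of a closed walk along it, a list of `m + 1`
vertices. -/
theorem card_oddCycle_le [Fintype (OddCycle G)] (m : ℕ) :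
    (Finset.univ.filter fun C : OddCycle G => C.1.verts.ncard = m).card ≤
      Fintype.card V ^ (m + 1) := by
  classical
  rw [← card_vector, ← Fintype.card_subtype]
  have hex : ∀ C : {C : OddCycle G // C.1.verts.ncard = m}, ∃ l : List.Vector V (m + 1),
      ∃ (u : V) (w : G.Walk u u), w.support = l.1 ∧ w.toSubgraph = C.1.1 := by
    rintro ⟨C, rfl⟩
    exact C.exists_support
  choose g hg using hex
  refine Fintype.card_le_of_injective g fun C C' h => ?_
  obtain ⟨u, w, h1, h2⟩ := hg C
  obtain ⟨u', w', h1', h2'⟩ := hg C'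
  refine Subtype.ext (Subtype.ext ?_)
  rw [← h2, ← h2']
  exact toSubgraph_eq_of_support_eq w w' (by rw [h1, h1', h])

theorem sum_oddCycle_le [Fintype (OddCycle G)] (hn : 2 ≤ Fintype.card V) :
    ∑ C : OddCycle G, ((Fintype.card V : ℝ)⁻¹) ^ (9 * (C.1.verts.ncard / 2)) ≤ 1 / 4 := by
  classical
  set n := Fintype.card V with hnV
  have hn' : (2 : ℝ) ≤ n := by exact_mod_cast hn
  have hn0 : (0 : ℝ) < n := by linarith
  have ht1 : (n : ℝ)⁻¹ ≤ 1 := inv_le_one_of_one_le₀ (by linarith)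
  have ht0 : 0 ≤ (n : ℝ)⁻¹ := by positivity
  -- For odd `m ≥ 3` one has `9 ⌊m / 2⌋ ≥ 5 + (m + 1)`, with equality for triangles; this explains
  -- the exponent 9.
  have hterm : ∀ C : OddCycle G, ((n : ℝ)⁻¹) ^ (9 * (C.1.verts.ncard / 2)) ≤
      ((n : ℝ)⁻¹) ^ 5 * ((n : ℝ)⁻¹) ^ (C.1.verts.ncard + 1) := by
    intro C
    obtain ⟨h3, k, hk⟩ := C.three_le_ncard
    rw [← pow_add]
    exact pow_le_pow_of_le_one ht0 ht1 (by omega)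
  have hsum : ∑ C : OddCycle G, ((n : ℝ)⁻¹) ^ (C.1.verts.ncard + 1) ≤ n + 1 := by
    rw [← Finset.sum_fiberwise_of_maps_to (t := Finset.range (n + 1))
      (g := fun C : OddCycle G => C.1.verts.ncard)]
    · have : ∀ m ∈ Finset.range (n + 1),
          ∑ C : OddCycle G with C.1.verts.ncard = m, ((n : ℝ)⁻¹) ^ (C.1.verts.ncard + 1) ≤ 1 := by
        intro m _
        calc _ = ∑ C : OddCycle G with C.1.verts.ncard = m, ((n : ℝ)⁻¹) ^ (m + 1) :=
              Finset.sum_congr rfl fun C hC => by rw [(Finset.mem_filter.1 hC).2]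
          _ = (Finset.univ.filter fun C : OddCycle G => C.1.verts.ncard = m).card *
                ((n : ℝ)⁻¹) ^ (m + 1) := by rw [Finset.sum_const, nsmul_eq_mul]
          _ ≤ (n : ℝ) ^ (m + 1) * ((n : ℝ)⁻¹) ^ (m + 1) := by
              refine mul_le_mul_of_nonneg_right ?_ (by positivity)
              exact_mod_cast card_oddCycle_le m
          _ = 1 := by rw [← mul_pow, mul_inv_cancel₀ hn0.ne', one_pow]
      refine (Finset.sum_le_sum this).trans ?_
      simp
    · intro C _
      rw [Finset.mem_range, Nat.lt_succ_iff, hnV, ← Nat.card_eq_fintype_card]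
      exact Set.ncard_le_card _
  calc _ ≤ ∑ C : OddCycle G, ((n : ℝ)⁻¹) ^ 5 * ((n : ℝ)⁻¹) ^ (C.1.verts.ncard + 1) :=
        Finset.sum_le_sum fun C _ => hterm C
    _ ≤ ((n : ℝ)⁻¹) ^ 5 * (n + 1) := by
        rw [← Finset.mul_sum]
        exact mul_le_mul_of_nonneg_left hsum (by positivity)
    _ ≤ 1 / 4 := by
        rw [inv_pow, inv_mul_le_iff₀ (by positivity)]
        have : (2 : ℝ) ^ 4 ≤ (n : ℝ) ^ 4 := pow_le_pow_left₀ (by norm_num) hn' 4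
        nlinarith

theorem sum_edgeSet_le [Fintype G.edgeSet] (hn : 2 ≤ Fintype.card V) :
    ∑ _e : G.edgeSet, ((Fintype.card V : ℝ)⁻¹) ^ 9 ≤ 1 / 4 := by
  classical
  set n := Fintype.card V with hnV
  have hn' : (2 : ℝ) ≤ n := by exact_mod_cast hn
  have hcard : Fintype.card G.edgeSet ≤ n * n := by
    rw [hnV, ← Fintype.card_prod]
    refine (Fintype.card_subtype_le _).trans ?_
    exact Fintype.card_le_of_surjective (fun p : V × V => s(p.1, p.2))
      (Sym2.ind fun a b => ⟨(a, b), rfl⟩)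
  rw [Finset.sum_const, Finset.card_univ, nsmul_eq_mul]
  calc (Fintype.card G.edgeSet : ℝ) * ((n : ℝ)⁻¹) ^ 9 ≤ (n * n : ℝ) * ((n : ℝ)⁻¹) ^ 9 := by
        refine mul_le_mul_of_nonneg_right ?_ (by positivity)
        exact_mod_cast hcard
    _ = ((n : ℝ) ^ 7)⁻¹ := by
        have : (n : ℝ) ≠ 0 := by linarith
        field_simp
    _ ≤ 1 / 4 := by
        rw [one_div]
        refine inv_anti₀ (by norm_num) ?_
        have := pow_le_pow_left₀ (by norm_num) hn' 7
        linarith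

theorem sum_stableSystem_le (hn : 2 ≤ Fintype.card V) :
    ∑ i, ((Fintype.card V : ℝ)⁻¹) ^ (9 * (stableSystem G).b i) ≤ 1 / 2 := by
  have : Fintype G.edgeSet := Fintype.ofFinite _
  have : Fintype (OddCycle G) := Fintype.ofFinite _
  rw [sum_sum_type_of_instance]
  have h1 := sum_edgeSet_le (G := G) hn
  have h2 := sum_oddCycle_le (G := G) hn
  simp only [stableSystem, mul_one]
  linarith

theorem isSparse_stableSystem (hn : 2 ≤ Fintype.card V) :
    (stableSystem G).IsSparse (Fintype.card V) where
  A_le_one := by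
    rintro (e | C) u <;> simp only [stableSystem] <;> split_ifs <;> simp
  b_pos := by
    rintro (e | C)
    · simp [stableSystem]
    · have := C.three_le_ncard.1
      simp only [stableSystem]
      omega
  sum_A_le := by
    classical
    rintro (⟨e, he⟩ | C)
    · induction e with
      | _ a b =>
        simp only [stableSystem, Finset.sum_boole]
        have : (Finset.univ.filter fun u => u ∈ s(a, b)) ⊆ {a, b} := by
          intro u
          simp
        refine (Finset.card_le_card this).trans (Finset.card_le_two.trans (by norm_num))
    · simp only [stableSystem, Finset.sum_boole]
      have h1 : (Finset.univ.filter fun u => u ∈ C.1.verts).card = C.1.verts.ncard := by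
        rw [← Set.ncard_coe_finset]
        congr 1
        ext u
        simp
      have := C.three_le_ncard.1
      rw [Nat.cast_id]
      omega
  exists_unit := by
    rintro (e | C) u hu
    · refine ⟨Sum.inl e, ?_, rfl⟩
      simp only [stableSystem] at hu ⊢
      simpa using hu
    · have hmem : u ∈ C.1.verts := by
        simp only [stableSystem] at hu
        simpa using hu
      obtain ⟨v, hv⟩ := C.exists_adj hmem
      exact ⟨Sum.inl ⟨s(u, v), hv⟩, by simp [stableSystem], rfl⟩
  sum_inv_pow_le := (sum_stableSystem_le hn).trans (by norm_num)

theorem indicator_mem_relaxation [DecidableEq V] {S : Finset V} (hS : G.IsIndepSet (S : Set V)) :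
    (fun u => if u ∈ S then (1 : ℝ) else 0) ∈ (stableSystem G).relaxation := by
  classical
  have hadj : ∀ a b, G.Adj a b → ¬ (a ∈ S ∧ b ∈ S) := fun a b hab h =>
    hS (Finset.mem_coe.2 h.1) (Finset.mem_coe.2 h.2) hab.ne hab
  refine ⟨fun u => by dsimp only; split_ifs <;> simp, ?_⟩
  have hcast : ∀ i, ∑ u, ((stableSystem G).A i u : ℝ) * (if u ∈ S then (1 : ℝ) else 0) =
      ((∑ u ∈ S, (stableSystem G).A i u : ℕ) : ℝ) := by
    intro i
    push_cast
    simp [Finset.sum_ite_mem]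
  intro i
  rw [hcast, Nat.cast_le]
  rcases i with ⟨e, he⟩ | ⟨H, u, w, hw, hodd, rfl⟩
  · induction e with
    | _ a b =>
      have hsum : ∑ u ∈ S, (stableSystem G).A (Sum.inl ⟨s(a, b), he⟩) u =
          (S.filter fun u => u ∈ s(a, b)).card := by
        rw [Finset.card_filter]
        exact Finset.sum_congr rfl fun u _ => by simp [stableSystem]
      rw [hsum]
      simp only [stableSystem]
      rw [Finset.card_le_one]
      intro x hx y hy
      simp only [Finset.mem_filter, Sym2.mem_iff] at hx hy
      have := hadj a b he
      have := hadj b a he.symm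
      rcases hx with ⟨hx, rfl | rfl⟩ <;> rcases hy with ⟨hy, rfl | rfl⟩ <;> tauto
  · simp only [stableSystem, IsCycle.ncard_verts hw]
    rw [Nat.le_div_iff_mul_le two_pos, mul_comm]
    refine le_trans (le_of_eq ?_) (two_mul_sum_support_tail_le w
      (fun u => if u ∈ S then 1 else 0) fun a b hab => ?_)
    · congr 1
      rw [← List.sum_toFinset _ hw.support_nodup]
      simp only [IsCycle.mem_verts_iff hw, ← List.mem_toFinset]
      rw [Finset.sum_ite_mem, Finset.sum_ite_mem, Finset.inter_comm]
    · have := hadj a b hab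
      split_ifs <;> first | omega | tauto

/-- The support of an integral optimal solution is stable by the edge inequalities, so the LP value
is the weight of a stable set. -/
theorem IsTPerfect.sum_mul_le [DecidableEq V] (hG : IsTPerfect G) {c : V → ℕ} {S : Finset V}
    (hS : IsApproxStableSet G 1 c S) {x : V → ℝ} (hx : x ∈ (stableSystem G).relaxation) :
    ∑ u, (c u : ℝ) * x u ≤ ∑ u ∈ S, (c u : ℝ) := by
  classical
  obtain ⟨z, ⟨hz, hopt⟩, h01⟩ := hG c
  refine (hopt x hx).trans ?_
  have hind : G.IsIndepSet ((Finset.univ.filter fun u => z u = 1 : Finset V) : Set V) := by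
    intro a ha b hb hab hadj
    simp only [Finset.coe_filter, Finset.mem_univ, true_and, Set.mem_ofPred_eq] at ha hb
    have h1 := hz.2 (Sum.inl ⟨s(a, b), hadj⟩)
    have h2 := Finset.sum_le_sum_of_subset_of_nonneg (Finset.subset_univ {a, b})
      (f := fun u => ((stableSystem G).A (Sum.inl ⟨s(a, b), hadj⟩) u : ℝ) * z u)
      fun u _ _ => mul_nonneg (Nat.cast_nonneg _) (hz.1 u).1
    rw [Finset.sum_pair hab] at h2
    simp only [stableSystem, Sym2.mem_iff, true_or, or_true, if_true, ha, hb] at h1 h2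
    norm_num at h1 h2
    linarith
  refine le_trans (le_of_eq ?_) ((one_mul _).symm.le.trans (hS.2 _ hind))
  rw [Finset.sum_filter]
  refine Finset.sum_congr rfl fun u _ => ?_
  rcases h01 u with h | h <;> simp [h]

end Graph

/-! ### Sums over discrete laws, and independence of the weights -/

theorem tsum_bind_mul {α β : Type*} (p : PMF α) (f : α → PMF β) (φ : β → ENNReal) :
    ∑' b, (p.bind f) b * φ b = ∑' a, p a * ∑' b, f a b * φ b := by
  simp only [PMF.bind_apply, ← ENNReal.tsum_mul_right, ← ENNReal.tsum_mul_left]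
  rw [ENNReal.tsum_comm]
  simp only [mul_assoc]

theorem tsum_map_mul {α β : Type*} (p : PMF α) (g : α → β) (φ : β → ENNReal) :
    ∑' b, (p.map g) b * φ b = ∑' a, p a * φ (g a) := by
  classical
  rw [← PMF.bind_pure_comp, tsum_bind_mul]
  refine tsum_congr fun a => ?_
  congr 1
  rw [tsum_eq_single (g a)]
  · simp
  · intro b hb
    simp [hb]

theorem map_cons_apply {α : Type*} (p : PMF α) (l : List α) (a : α) :
    (p.map fun b => b :: l) (a :: l) = p a := by
  classical
  rw [PMF.map_apply, tsum_eq_single a]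
  · simp
  · intro b hb
    simp [hb.symm]

theorem map_cons_apply_of_ne {α : Type*} (p : PMF α) {l l' : List α} (a : α) (h : l' ≠ l) :
    (p.map fun b => b :: l) (a :: l') = 0 := by
  classical
  rw [PMF.map_apply]
  simp [h]

section Independence

variable {V Ω : Type*} [Fintype V] [MeasurableSpace Ω] {Pr : Measure Ω} {X : V → Ω → ℕ}

theorem measurable_comp_weights (hX : ∀ j, Measurable (X j)) {β : Type*} [MeasurableSpace β]
    (F : (V → ℕ) → β) : Measurable fun ω => F fun j => X j ω :=
  (Measurable.of_discrete (f := F)).comp (measurable_pi_lambda _ hX)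

/-- For a fixed history, `F` depends on the weights queried so far (`R`) and the event concerns
newly queried ones (`Q`), so the integral factors. -/
theorem lintegral_comp_mul_indicator (hX : ∀ j, Measurable (X j)) (hind : iIndepFun X Pr)
    (F : (V → ℕ) → ENNReal) {R Q : Finset V} (hRQ : Disjoint R Q)
    (hF : ∀ c c' : V → ℕ, (∀ j ∈ R, c j = c' j) → F c = F c') (B : V → Set ℕ) :
    ∫⁻ ω, F (fun j => X j ω) * (⋂ j ∈ Q, X j ⁻¹' B j).indicator 1 ω ∂Pr =
      (∫⁻ ω, F (fun j => X j ω) ∂Pr) * ∏ j ∈ Q, Pr (X j ⁻¹' B j) := by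
  classical
  have hE : MeasurableSet (⋂ j ∈ Q, X j ⁻¹' B j) :=
    Finset.measurableSet_biInter _ fun j _ => hX j .of_discrete
  have h1 : (fun ω => F fun j => X j ω) =
      (fun r : R → ℕ => F fun j => if h : j ∈ R then r ⟨j, h⟩ else 0) ∘ fun ω (j : R) => X j ω := by
    funext ω
    refine hF _ _ fun j hj => ?_
    simp [hj]
  have h2 : (⋂ j ∈ Q, X j ⁻¹' B j).indicator (1 : Ω → ENNReal) =
      (fun r : Q → ℕ => Set.indicator {r : Q → ℕ | ∀ j : Q, r j ∈ B j} 1 r) ∘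
        fun ω (j : Q) => X j ω := by
    funext ω
    by_cases h : ∀ j ∈ Q, X j ω ∈ B j
    · rw [Set.indicator_of_mem (by simpa using h)]
      simp only [Function.comp]
      rw [Set.indicator_of_mem (by simpa using h)]
      rfl
    · rw [Set.indicator_of_notMem (by simpa using h)]
      simp only [Function.comp]
      rw [Set.indicator_of_notMem (by simpa using h)]
  have hXm : ∀ S : Finset V, Measurable fun ω (j : S) => X j ω := fun S =>
    measurable_pi_lambda _ fun j => hX j
  have hindep : IndepFun (fun ω => F fun j => X j ω)
      ((⋂ j ∈ Q, X j ⁻¹' B j).indicator (1 : Ω → ENNReal)) Pr := by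
    rw [h1, h2]
    exact (hind.indepFun_finset R Q hRQ hX).comp .of_discrete .of_discrete
  rw [lintegral_mul_eq_lintegral_mul_lintegral_of_indepFun'' _ _ hindep,
    lintegral_indicator_one hE, hind.measure_inter_preimage_eq_mul Q fun _ _ => .of_discrete]
  · rw [h1]
    exact (Measurable.of_discrete.comp (hXm R)).aemeasurable
  · exact (measurable_one.indicator hE).aemeasurable

end Independence

/-! ### Histories of the strategy and survival of a dual vector -/

section Strategy

variable {V : Type*} [DecidableEq V] {G : SimpleGraph V}

theorem queried_cons (Q : Finset V) (h : List (Finset V)) : queried (Q :: h) = Q ∪ queried h := rfl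

theorem revealedWeights_congr {c c' : V → ℕ} (d : V → ℕ) {h : List (Finset V)}
    (hc : ∀ j ∈ queried h, c j = c' j) : revealedWeights c d h = revealedWeights c' d h := by
  funext j
  simp only [revealedWeights]
  split_ifs with hj
  · exact hc j hj
  · rfl

variable [Fintype V]

/-- The sum factors over the elements: `j ∈ J` contributes `1 - x j + x j * a j ≤ 1 - p * x j ≤ exp
(-p * x j)`, all others at most 1. -/
theorem sum_querySet_mul_prod_le {x : V → ℝ} (hx : ∀ j, x j ∈ Set.Icc (0 : ℝ) 1) {R J : Finset V}
    (hJ : Disjoint J R) {a : V → ENNReal} (ha : ∀ j, a j ≤ 1) {p : ℝ} (hp : p ≤ 1)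
    (haJ : ∀ j ∈ J, a j ≤ ENNReal.ofReal (1 - p)) :
    ∑ Q, querySet x hx Q * ∏ j ∈ Q \ R, a j ≤
      ENNReal.ofReal (Real.exp (-(p * ∑ j ∈ J, x j))) := by
  have h1 : ∀ Q : Finset V, querySet x hx Q * ∏ j ∈ Q \ R, a j =
      (∏ j ∈ Q, ENNReal.ofReal (x j) * if j ∈ R then 1 else a j) *
        ∏ j ∈ Finset.univ \ Q, ENNReal.ofReal (1 - x j) := by
    intro Q
    have : ∏ j ∈ Q \ R, a j = ∏ j ∈ Q, if j ∈ R then 1 else a j := by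
      rw [Finset.sdiff_eq_filter, Finset.prod_filter]
      exact Finset.prod_congr rfl fun j _ => by split_ifs <;> tauto
    rw [this, Finset.prod_mul_distrib, querySet, PMF.ofFintype_apply]
    ring
  rw [Finset.sum_congr rfl fun Q _ => h1 Q, ← Finset.powerset_univ, ← Finset.prod_add]
  have h2 : ENNReal.ofReal (Real.exp (-(p * ∑ j ∈ J, x j))) =
      ∏ j, if j ∈ J then ENNReal.ofReal (Real.exp (-(p * x j))) else 1 := by
    rw [Finset.mul_sum, ← Finset.sum_neg_distrib, Real.exp_sum,
      ENNReal.ofReal_prod_of_nonneg fun _ _ => (Real.exp_pos _).le, Finset.prod_ite_mem,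
      Finset.univ_inter]
  rw [h2]
  refine Finset.prod_le_prod' fun j _ => ?_
  have h0 := (hx j).1
  have h1' := (hx j).2
  split_ifs with hR hjJ hjJ
  · exact absurd hR (Finset.disjoint_left.1 hJ hjJ)
  · rw [mul_one, ← ENNReal.ofReal_add h0 (by linarith)]
    simp
  · calc _ ≤ ENNReal.ofReal (x j) * ENNReal.ofReal (1 - p) + ENNReal.ofReal (1 - x j) := by
          gcongr
          exact haJ j hjJ
      _ = ENNReal.ofReal (-(p * x j) + 1) := by
          rw [← ENNReal.ofReal_mul h0, ← ENNReal.ofReal_add (mul_nonneg h0 (by linarith))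
            (by linarith)]
          congr 1
          ring
      _ ≤ _ := ENNReal.ofReal_le_ofReal (Real.add_one_le_exp _)
  · calc _ ≤ ENNReal.ofReal (x j) * 1 + ENNReal.ofReal (1 - x j) := by
          gcongr
          exact ha j
      _ = 1 := by
          rw [mul_one, ← ENNReal.ofReal_add h0 (by linarith)]
          simp

namespace AdaptiveStrategy

variable (s : AdaptiveStrategy G)

/-- The law of the next query set. -/
noncomputable def nextQuery (cplus c : V → ℕ) (h : List (Finset V)) : PMF (Finset V) :=
  querySet (s.lpSolution h (revealedWeights c cplus h))
    (s.lpSolution_optimal h (revealedWeights c cplus h)).1.1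

theorem queries_succ (cplus c : V → ℕ) (t : ℕ) : s.queries cplus c (t + 1) =
    (s.queries cplus c t).bind fun h => (s.nextQuery cplus c h).map fun Q => Q :: h := rfl

theorem nextQuery_congr (cplus : V → ℕ) {c c' : V → ℕ} {h : List (Finset V)}
    (hc : ∀ j ∈ queried h, c j = c' j) : s.nextQuery cplus c h = s.nextQuery cplus c' h := by
  have := revealedWeights_congr cplus hc
  simp only [nextQuery, this]

/-- The strategy sees only queried weights. This is what leaves the other weights independent of the
history. -/
theorem queries_congr (cplus : V → ℕ) {c c' : V → ℕ} (t : ℕ) {h : List (Finset V)}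
    (hc : ∀ j ∈ queried h, c j = c' j) : s.queries cplus c t h = s.queries cplus c' t h := by
  induction t generalizing h with
  | zero => rfl
  | succ t ih =>
    rw [queries_succ, queries_succ, PMF.bind_apply, PMF.bind_apply]
    refine tsum_congr fun h' => ?_
    cases h with
    | nil =>
      classical
      simp [PMF.map_apply]
    | cons Q h =>
      by_cases hh : h = h'
      · subst hh
        have hc' : ∀ j ∈ queried h, c j = c' j := fun j hj =>
          hc j (by rw [queried_cons]; exact Finset.mem_union_right _ hj)
        rw [map_cons_apply, map_cons_apply, ih hc', s.nextQuery_congr cplus hc']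
      · rw [map_cons_apply_of_ne _ _ hh, map_cons_apply_of_ne _ _ hh, mul_zero, mul_zero]

theorem tsum_queries_succ_mul (cplus c : V → ℕ) (t : ℕ) (φ : List (Finset V) → ENNReal) :
    ∑' h, s.queries cplus c (t + 1) h * φ h =
      ∑' h, s.queries cplus c t h * ∑ Q, s.nextQuery cplus c h Q * φ (Q :: h) := by
  rw [queries_succ, tsum_bind_mul]
  refine tsum_congr fun h => ?_
  rw [tsum_map_mul, tsum_fintype]

end AdaptiveStrategy

/-- The dual vector `y` has survived the queries `h`: it still covers the pessimistic weights, while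
the optimistic LP value is at least `μ`. -/
def Survives (G : SimpleGraph V) (cminus cplus : V → ℕ) (μ : ℝ) (y : EdgeOrOddCycle G ⊕ V → ℝ)
    (c : V → ℕ) (h : List (Finset V)) : Prop :=
  (stableSystem G).boxed.DualCovers (revealedWeights c cminus h) y ∧
    ∃ x ∈ (stableSystem G).relaxation, μ ≤ ∑ j, (revealedWeights c cplus h j : ℝ) * x j

theorem Survives.congr {cminus cplus : V → ℕ} {μ : ℝ} {y : EdgeOrOddCycle G ⊕ V → ℝ}
    {c c' : V → ℕ} {h : List (Finset V)} (hc : ∀ j ∈ queried h, c j = c' j) :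
    Survives G cminus cplus μ y c h ↔ Survives G cminus cplus μ y c' h := by
  rw [Survives, Survives, revealedWeights_congr cminus hc, revealedWeights_congr cplus hc]

/-- Along a history the pessimistic weights only grow and the optimistic ones only shrink, so
survival is inherited by earlier histories. -/
theorem Survives.of_cons {cminus cplus : V → ℕ} {μ : ℝ} {y : EdgeOrOddCycle G ⊕ V → ℝ}
    {c : V → ℕ} {Q : Finset V} {h : List (Finset V)} (hc : ∀ j, c j ∈ Set.Icc (cminus j) (cplus j))
    (hs : Survives G cminus cplus μ y c (Q :: h)) :
    Survives G cminus cplus μ y c h ∧ ∀ j ∈ Q \ queried h,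
      (c j : ℝ) ≤ ∑ i, y i * ((stableSystem G).boxed.A i j : ℝ) := by
  obtain ⟨h1, x, hx, h2⟩ := hs
  refine ⟨⟨fun j => le_trans ?_ (h1 j), x, hx, h2.trans ?_⟩, fun j hj => ?_⟩
  · rw [Nat.cast_le]
    have := (hc j).1
    simp only [revealedWeights, queried_cons, Finset.mem_union]
    split_ifs <;> first | omega | tauto
  · refine Finset.sum_le_sum fun j _ => mul_le_mul_of_nonneg_right ?_ (hx.1 j).1
    rw [Nat.cast_le]
    have := (hc j).2
    simp only [revealedWeights, queried_cons, Finset.mem_union]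
    split_ifs <;> first | omega | tauto
  · have := h1 j
    rwa [revealedWeights, if_pos] at this
    rw [queried_cons]
    exact Finset.mem_union_left _ (Finset.mem_sdiff.1 hj).1

/-- While `y` survives, an optimal solution to the optimistic LP puts much weight on the elements
that can falsify `y`. -/
theorem Survives.le_sum {cminus cplus : V → ℕ} {μ ε : ℝ} {y : EdgeOrOddCycle G ⊕ V → ℝ}
    {c : V → ℕ} {h : List (Finset V)} (hs : Survives G cminus cplus μ y c h) (hy : ∀ i, 0 ≤ y i)
    (hval : (stableSystem G).boxed.dualValue y ≤ (1 - ε / 2) * μ) {x : V → ℝ}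
    (hx : (stableSystem G).IsLPOptimal (revealedWeights c cplus h) x) :
    ε / 2 * μ ≤ ((Finset.univ.sup fun j => cplus j - cminus j : ℕ) : ℝ) *
      ∑ j with j ∉ queried h ∧ ∑ i, y i * ((stableSystem G).boxed.A i j : ℝ) < cplus j, x j := by
  obtain ⟨h1, x', hx', h2⟩ := hs
  obtain ⟨⟨hx01, hxA⟩, hopt⟩ := hx
  set Y : V → ℝ := fun j => ∑ i, y i * ((stableSystem G).boxed.A i j : ℝ) with hY
  set D : ℕ := Finset.univ.sup fun j => cplus j - cminus j with hD
  have hrow : ∀ i, ∑ j, ((stableSystem G).boxed.A i j : ℝ) * x j ≤ (stableSystem G).boxed.b i := by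
    rintro (i | k)
    · exact hxA i
    · simpa [PackingSystem.boxed] using (hx01 k).2
  have hYx : ∑ j, Y j * x j ≤ (1 - ε / 2) * μ := by
    refine le_trans ?_ hval
    calc ∑ j, Y j * x j = ∑ i, y i * ∑ j, ((stableSystem G).boxed.A i j : ℝ) * x j := by
          simp only [hY, Finset.sum_mul, Finset.mul_sum]
          rw [Finset.sum_comm]
          simp only [mul_assoc]
      _ ≤ _ := Finset.sum_le_sum fun i _ => mul_le_mul_of_nonneg_left (hrow i) (hy i)
  have hμ := h2.trans (hopt x' hx')
  calc ε / 2 * μ ≤ ∑ j, ((revealedWeights c cplus h j : ℝ) - Y j) * x j := by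
        simp only [sub_mul, Finset.sum_sub_distrib]
        linarith
    -- On queried elements both weights are the realized one, which `y` covers. On the others `Y j ≥
    -- c⁻ j`, so the excess of `c⁺ j` over `Y j` is at most `D`.
    _ ≤ ∑ j, if j ∉ queried h ∧ Y j < cplus j then (D : ℝ) * x j else 0 := by
        refine Finset.sum_le_sum fun j _ => ?_
        have hj := h1 j
        have hle : ((revealedWeights c cplus h j : ℝ) - Y j) ≤ 0 →
            ((revealedWeights c cplus h j : ℝ) - Y j) * x j ≤ 0 :=
          fun h => mul_nonpos_of_nonpos_of_nonneg h (hx01 j).1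
        by_cases hq : j ∈ queried h
        · simp only [revealedWeights, hq, if_true, not_true_eq_false, false_and, if_false] at hj hle ⊢
          exact hle (sub_nonpos.2 hj)
        · simp only [revealedWeights, hq, if_false, not_false_eq_true, true_and] at hj hle ⊢
          split_ifs with hlt
          · refine mul_le_mul_of_nonneg_right ?_ (hx01 j).1
            have hDj : cplus j - cminus j ≤ D :=
              Finset.le_sup (f := fun j => cplus j - cminus j) (Finset.mem_univ j)
            have : (cplus j : ℝ) ≤ D + cminus j := by exact_mod_cast Nat.sub_le_iff_le_add.1 hDj
            have hj' : (cminus j : ℝ) ≤ Y j := hj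
            linarith
          · exact hle (by linarith)
    _ = _ := by rw [← Finset.sum_filter, Finset.mul_sum]

/-! ### Decay of the survival probability -/

section Probability

variable {Ω : Type*} [MeasurableSpace Ω] {Pr : Measure Ω} [IsProbabilityMeasure Pr]
  {cminus cplus : V → ℕ} {ctilde : V → Ω → ℕ} {p : ℝ}

-- Surviving one more iteration requires surviving so far and that no newly queried weight exceeds
-- its cover. Given the history, `Survives.le_sum` and `sum_querySet_mul_prod_le` bound the
-- probability of the latter.
open scoped Classical in
theorem lintegral_survives_succ_le (hmeas : ∀ j, Measurable (ctilde j))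
    (hind : iIndepFun ctilde Pr)
    (hbox : ∀ j, ∀ᵐ ω ∂Pr, ctilde j ω ∈ Set.Icc (cminus j) (cplus j)) (hp0 : 0 < p)
    (hp : ∀ j, p ≤ Pr.real {ω | ctilde j ω = cplus j}) (s : AdaptiveStrategy G) {ε μ : ℝ}
    (hD : 0 < (Finset.univ.sup fun j => cplus j - cminus j : ℕ)) (hp1 : p ≤ 1)
    {y : EdgeOrOddCycle G ⊕ V → ℝ} (hy : ∀ i, 0 ≤ y i)
    (hval : (stableSystem G).boxed.dualValue y ≤ (1 - ε / 2) * μ) (t : ℕ) :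
    ∫⁻ ω, ∑' h, s.queries cplus (fun j => ctilde j ω) (t + 1) h *
        (if Survives G cminus cplus μ y (fun j => ctilde j ω) h then 1 else 0) ∂Pr ≤
      ENNReal.ofReal (Real.exp (-(p * (ε / 2 * μ /
        ((Finset.univ.sup fun j => cplus j - cminus j : ℕ) : ℝ))))) *
      ∫⁻ ω, ∑' h, s.queries cplus (fun j => ctilde j ω) t h *
        (if Survives G cminus cplus μ y (fun j => ctilde j ω) h then 1 else 0) ∂Pr := by
  set D : ℕ := Finset.univ.sup fun j => cplus j - cminus j with hDdef
  set Y : V → ℝ := fun j => ∑ i, y i * ((stableSystem G).boxed.A i j : ℝ) with hY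
  set B : V → Set ℕ := fun j => {k | (k : ℝ) ≤ Y j} with hB
  set ρ := ENNReal.ofReal (Real.exp (-(p * (ε / 2 * μ / (D : ℝ))))) with hρ
  set g : (V → ℕ) → List (Finset V) → ENNReal := fun c h =>
    s.queries cplus c t h * (if Survives G cminus cplus μ y c h then 1 else 0) with hg
  have hgcongr : ∀ (h : List (Finset V)) (c c' : V → ℕ), (∀ j ∈ queried h, c j = c' j) →
      g c h = g c' h := fun h c c' hc => by
    simp only [hg, s.queries_congr cplus t hc, Survives.congr hc]
  have hbox' : ∀ᵐ ω ∂Pr, ∀ j, ctilde j ω ∈ Set.Icc (cminus j) (cplus j) := ae_all_iff.2 hbox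
  have ha1 : ∀ j, Pr (ctilde j ⁻¹' B j) ≤ 1 := fun j => prob_le_one
  have haJ : ∀ j, Y j < cplus j → Pr (ctilde j ⁻¹' B j) ≤ ENNReal.ofReal (1 - p) := by
    intro j hj
    have hE : MeasurableSet {ω | ctilde j ω = cplus j} := hmeas j (.of_discrete (s := {cplus j}))
    have hsub : ctilde j ⁻¹' B j ⊆ {ω | ctilde j ω = cplus j}ᶜ := by
      intro ω hω heq
      have h1 : (ctilde j ω : ℝ) ≤ Y j := hω
      have h2 : ctilde j ω = cplus j := heq
      rw [h2] at h1
      linarith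
    refine (measure_mono hsub).trans ?_
    rw [← ofReal_measureReal, probReal_compl_eq_one_sub hE]
    exact ENNReal.ofReal_le_ofReal (by linarith [hp j])
  have hsum : ∀ (c : V → ℕ) (h : List (Finset V)), Survives G cminus cplus μ y c h →
      ∑ Q, s.nextQuery cplus c h Q * ∏ j ∈ Q \ queried h, Pr (ctilde j ⁻¹' B j) ≤ ρ := by
    intro c h hs
    have hopt := s.lpSolution_optimal h (revealedWeights c cplus h)
    have h1 := hs.le_sum hy hval hopt
    refine (sum_querySet_mul_prod_le hopt.1.1
      (J := Finset.univ.filter fun j => j ∉ queried h ∧ Y j < cplus j) ?_ ha1 hp1 ?_).trans ?_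
    · rw [Finset.disjoint_left]
      intro j hj
      exact (Finset.mem_filter.1 hj).2.1
    · intro j hj
      exact haJ j (Finset.mem_filter.1 hj).2.2
    · refine ENNReal.ofReal_le_ofReal (Real.exp_le_exp.2 (neg_le_neg ?_))
      refine mul_le_mul_of_nonneg_left ?_ hp0.le
      rw [div_le_iff₀ (by exact_mod_cast hD)]
      exact h1.trans_eq (mul_comm _ _)
  calc ∫⁻ ω, ∑' h, s.queries cplus (fun j => ctilde j ω) (t + 1) h *
        (if Survives G cminus cplus μ y (fun j => ctilde j ω) h then 1 else 0) ∂Pr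
      ≤ ∫⁻ ω, ∑' h, ∑ Q, (g (fun j => ctilde j ω) h *
          s.nextQuery cplus (fun j => ctilde j ω) h Q) *
          (⋂ j ∈ Q \ queried h, ctilde j ⁻¹' B j).indicator 1 ω ∂Pr := by
        refine lintegral_mono_ae ?_
        filter_upwards [hbox'] with ω hω
        rw [s.tsum_queries_succ_mul]
        refine ENNReal.tsum_le_tsum fun h => ?_
        rw [Finset.mul_sum]
        refine Finset.sum_le_sum fun Q _ => ?_
        split_ifs with hS
        · obtain ⟨h1, h2⟩ := hS.of_cons hω
          rw [Set.indicator_of_mem (Set.mem_iInter₂.2 h2)]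
          simp [hg, h1]
        · simp
    _ = ∑' h, ∑ Q, ∫⁻ ω, (g (fun j => ctilde j ω) h *
          s.nextQuery cplus (fun j => ctilde j ω) h Q) *
          (⋂ j ∈ Q \ queried h, ctilde j ⁻¹' B j).indicator 1 ω ∂Pr := by
        have hm : ∀ (h : List (Finset V)) (Q : Finset V), Measurable fun ω =>
            (g (fun j => ctilde j ω) h * s.nextQuery cplus (fun j => ctilde j ω) h Q) *
            (⋂ j ∈ Q \ queried h, ctilde j ⁻¹' B j).indicator (1 : Ω → ENNReal) ω := fun h Q =>
          (measurable_comp_weights hmeas fun c => g c h * s.nextQuery cplus c h Q).mul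
            (measurable_one.indicator
              (Finset.measurableSet_biInter _ fun j _ => hmeas j .of_discrete))
        rw [lintegral_tsum fun h => (Finset.measurable_fun_sum _ fun Q _ => hm h Q).aemeasurable]
        exact tsum_congr fun h => lintegral_finsetSum _ fun Q _ => hm h Q
    -- Once `h` and `Q` are fixed, the first factor depends only on weights in `queried h`, which is
    -- disjoint from `Q \ queried h`.
    _ = ∑' h, ∑ Q, (∫⁻ ω, g (fun j => ctilde j ω) h *
          s.nextQuery cplus (fun j => ctilde j ω) h Q ∂Pr) *
          ∏ j ∈ Q \ queried h, Pr (ctilde j ⁻¹' B j) := by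
        refine tsum_congr fun h => Finset.sum_congr rfl fun Q _ => ?_
        exact lintegral_comp_mul_indicator hmeas hind
          (fun c => g c h * s.nextQuery cplus c h Q) Finset.disjoint_sdiff
          (fun c c' hc => by rw [hgcongr h c c' hc, s.nextQuery_congr cplus hc]) B
    _ = ∑' h, ∫⁻ ω, g (fun j => ctilde j ω) h * ∑ Q, s.nextQuery cplus (fun j => ctilde j ω) h Q *
          ∏ j ∈ Q \ queried h, Pr (ctilde j ⁻¹' B j) ∂Pr := by
        refine tsum_congr fun h => ?_
        simp only [Finset.mul_sum, ← mul_assoc]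
        rw [lintegral_finsetSum]
        · refine Finset.sum_congr rfl fun Q _ => ?_
          rw [lintegral_mul_const]
          exact measurable_comp_weights hmeas fun c => g c h * s.nextQuery cplus c h Q
        · intro Q _
          exact (measurable_comp_weights hmeas
            fun c => g c h * s.nextQuery cplus c h Q).mul_const _
    _ ≤ ∑' h, ∫⁻ ω, ρ * g (fun j => ctilde j ω) h ∂Pr := by
        refine ENNReal.tsum_le_tsum fun h => lintegral_mono fun ω => ?_
        by_cases hS : Survives G cminus cplus μ y (fun j => ctilde j ω) h
        · rw [mul_comm]
          gcongr
          exact hsum _ h hS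
        · simp [hg, hS]
    _ = ρ * ∫⁻ ω, ∑' h, g (fun j => ctilde j ω) h ∂Pr := by
        have hm : ∀ h, Measurable fun ω => g (fun j => ctilde j ω) h := fun h =>
          measurable_comp_weights hmeas fun c => g c h
        rw [lintegral_tsum fun h => (hm h).aemeasurable, ← ENNReal.tsum_mul_left]
        exact tsum_congr fun h => lintegral_const_mul _ (hm h)

open scoped Classical in
theorem lintegral_survives_le (hmeas : ∀ j, Measurable (ctilde j))
    (hind : iIndepFun ctilde Pr)
    (hbox : ∀ j, ∀ᵐ ω ∂Pr, ctilde j ω ∈ Set.Icc (cminus j) (cplus j)) (hp0 : 0 < p)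
    (hp : ∀ j, p ≤ Pr.real {ω | ctilde j ω = cplus j}) (s : AdaptiveStrategy G) {ε μ : ℝ}
    (hD : 0 < (Finset.univ.sup fun j => cplus j - cminus j : ℕ)) (hp1 : p ≤ 1)
    {y : EdgeOrOddCycle G ⊕ V → ℝ} (hy : ∀ i, 0 ≤ y i)
    (hval : (stableSystem G).boxed.dualValue y ≤ (1 - ε / 2) * μ) (t : ℕ) :
    ∫⁻ ω, ∑' h, s.queries cplus (fun j => ctilde j ω) t h *
        (if Survives G cminus cplus μ y (fun j => ctilde j ω) h then 1 else 0) ∂Pr ≤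
      ENNReal.ofReal (Real.exp (-(p * (ε / 2 * μ /
        ((Finset.univ.sup fun j => cplus j - cminus j : ℕ) : ℝ)) * t))) := by
  induction t with
  | zero =>
    calc _ ≤ ∫⁻ _ω, 1 ∂Pr := by
          refine lintegral_mono fun ω => ?_
          rw [← (s.queries cplus (fun j => ctilde j ω) 0).tsum_coe]
          refine ENNReal.tsum_le_tsum fun h => ?_
          split_ifs <;> simp
      _ ≤ _ := by simp
  | succ t ih =>
    refine (lintegral_survives_succ_le hmeas hind hbox hp0 hp s hD hp1 hy hval t).trans ?_
    refine (mul_le_mul_right ih _).trans ?_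
    rw [← ENNReal.ofReal_mul (Real.exp_pos _).le, ← Real.exp_add]
    refine ENNReal.ofReal_le_ofReal (Real.exp_le_exp.2 (le_of_eq ?_))
    push_cast
    ring

end Probability

end Strategy

/-! ### Union bound over the witness covers -/

section Main

variable {V : Type*} [Fintype V] [DecidableEq V] {G : SimpleGraph V}

open scoped Classical in
/-- If the output is not nearly optimal, then for the weight `m` of some stable set, a member of
the witness cover for `m` has survived. -/
theorem one_le_success_add_survives (hG : IsTPerfect G) {ε : ℝ}
    {W : ℕ → Finset (EdgeOrOddCycle G ⊕ V → ℝ)}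
    (hW : ∀ m : ℕ, 1 ≤ m → ∀ (c : V → ℕ) (y : EdgeOrOddCycle G ⊕ V → ℝ), (∀ i, 0 ≤ y i) →
      (stableSystem G).boxed.dualValue y ≤ (1 - ε) * m → (stableSystem G).boxed.DualCovers c y →
      ∃ y' ∈ W m, (stableSystem G).boxed.DualCovers c y')
    (s : AdaptiveStrategy G) {cminus cplus c : V → ℕ}
    (hc : ∀ j, c j ∈ Set.Icc (cminus j) (cplus j)) (T : ℕ) :
    1 ≤ (s.output cminus cplus c T).toOuterMeasure {S | IsApproxStableSet G (1 - ε) c S} +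
      ∑' m : ℕ, ∑ y ∈ W (m + 1), ∑' h, s.queries cplus c T h *
        (if Survives G cminus cplus ((m + 1 : ℕ) : ℝ) y c h then 1 else 0) := by
  have hpt : ∀ h : List (Finset V),
      (1 : ENNReal) ≤
        (if IsApproxStableSet G (1 - ε) c (s.finalSet h (revealedWeights c cminus h))
          then 1 else 0) +
        ∑' m : ℕ, ∑ y ∈ W (m + 1),
          (if Survives G cminus cplus ((m + 1 : ℕ) : ℝ) y c h then 1 else 0) := by
    intro h
    split_ifs with happ
    · exact le_self_add
    · have hfin := s.finalSet_optimal h (revealedWeights c cminus h)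
      set S := s.finalSet h (revealedWeights c cminus h) with hS
      obtain ⟨S', hS', hlt⟩ : ∃ S' : Finset V, G.IsIndepSet (S' : Set V) ∧
          ∑ u ∈ S, (c u : ℝ) < (1 - ε) * ∑ u ∈ S', (c u : ℝ) := by
        by_contra! hno
        exact happ ⟨hfin.1, hno⟩
      set M : ℕ := ∑ u ∈ S', c u with hM
      have hMc : ∑ u ∈ S', (c u : ℝ) = M := by rw [hM]; push_cast; rfl
      rw [hMc] at hlt
      have hpes : ∑ u ∈ S, (revealedWeights c cminus h u : ℝ) ≤ ∑ u ∈ S, (c u : ℝ) := by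
        refine Finset.sum_le_sum fun u _ => ?_
        rw [Nat.cast_le]
        have := (hc u).1
        simp only [revealedWeights]
        split_ifs <;> omega
      have hM1 : 1 ≤ M := by
        by_contra hM0
        have hM0 : M = 0 := by omega
        rw [hM0, Nat.cast_zero, mul_zero] at hlt
        exact absurd hlt (not_lt.2 (Finset.sum_nonneg fun _ _ => Nat.cast_nonneg _))
      -- By t-perfectness the returned set attains the pessimistic LP value, which is thus below `(1
      -- - ε) M`.
      obtain ⟨y, hy0, hyv, hyc⟩ := (stableSystem G).exists_dual_of_forall_lt
        (revealedWeights c cminus h) ((1 - ε) * M)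
        fun x hx => ((hG.sum_mul_le hfin hx).trans hpes).trans_lt hlt
      obtain ⟨y', hy'W, hy'c⟩ := hW M hM1 _ y hy0 hyv hyc
      -- The indicator vector of `S'` shows that the optimistic LP value is at least `M`.
      have hsurv : Survives G cminus cplus (M : ℝ) y' c h := by
        refine ⟨hy'c, _, indicator_mem_relaxation hS', ?_⟩
        rw [← hMc]
        simp only [mul_ite, mul_one, mul_zero, Finset.sum_ite_mem, Finset.univ_inter]
        refine Finset.sum_le_sum fun u _ => ?_
        rw [Nat.cast_le]
        have := (hc u).2
        simp only [revealedWeights]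
        split_ifs <;> omega
      obtain ⟨m, hm⟩ : ∃ m, M = m + 1 := ⟨M - 1, by omega⟩
      rw [zero_add]
      refine le_trans ?_ (ENNReal.le_tsum m)
      rw [← hm]
      refine le_trans (le_of_eq ?_) (Finset.single_le_sum (fun _ _ => zero_le) hy'W)
      rw [if_pos hsurv]
  calc 1 = ∑' h, s.queries cplus c T h * 1 := by simp [PMF.tsum_coe]
    _ ≤ ∑' h, s.queries cplus c T h * ((if IsApproxStableSet G (1 - ε) c
          (s.finalSet h (revealedWeights c cminus h)) then 1 else 0) +
        ∑' m : ℕ, ∑ y ∈ W (m + 1),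
          (if Survives G cminus cplus ((m + 1 : ℕ) : ℝ) y c h then 1 else 0)) :=
        ENNReal.tsum_le_tsum fun h => mul_le_mul_right (hpt h) _
    _ = _ := by
        simp only [mul_add]
        rw [ENNReal.tsum_add]
        congr 1
        · rw [AdaptiveStrategy.output, PMF.toOuterMeasure_map_apply, PMF.toOuterMeasure_apply]
          refine tsum_congr fun h => ?_
          simp [Set.indicator_apply]
        · simp only [← ENNReal.tsum_mul_left, Finset.mul_sum]
          rw [ENNReal.tsum_comm]
          refine tsum_congr fun m => ?_
          exact Summable.tsum_finsetSum fun _ _ => ENNReal.summable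

variable {Ω : Type*} [MeasurableSpace Ω] {Pr : Measure Ω} [IsProbabilityMeasure Pr]
  {cminus cplus : V → ℕ} {ctilde : V → Ω → ℕ} {p ε : ℝ}

/-- The degenerate case `Δ_c = 0`, where the decay rate would divide by zero: the weights are almost
surely known in advance. -/
theorem one_le_successProb_of_sup_eq_zero
    (hbox : ∀ j, ∀ᵐ ω ∂Pr, ctilde j ω ∈ Set.Icc (cminus j) (cplus j)) (hε : 0 < ε)
    (s : AdaptiveStrategy G) (hD : (Finset.univ.sup fun j => cplus j - cminus j : ℕ) = 0) (T : ℕ) :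
    1 ≤ s.successProb Pr cminus cplus ctilde T (1 - ε) := by
  have hle : ∀ j, cplus j ≤ cminus j := fun j => by
    have := Finset.le_sup (f := fun j => cplus j - cminus j) (Finset.mem_univ j)
    omega
  calc (1 : ENNReal) = ∫⁻ _ω, 1 ∂Pr := by simp
    _ ≤ _ := by
      refine lintegral_mono_ae ?_
      filter_upwards [ae_all_iff.2 hbox] with ω hω
      refine le_of_eq (Eq.symm ((PMF.toOuterMeasure_apply_eq_one_iff _ _).2 ?_))
      intro S hS
      rw [AdaptiveStrategy.output, PMF.mem_support_map_iff] at hS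
      obtain ⟨h, -, rfl⟩ := hS
      have hrev : revealedWeights (fun j => ctilde j ω) cminus h = fun j => ctilde j ω := by
        funext j
        have := (hω j).1
        have := (hω j).2
        have := hle j
        simp only [revealedWeights]
        split_ifs <;> omega
      have hfin := s.finalSet_optimal h (revealedWeights (fun j => ctilde j ω) cminus h)
      rw [hrev] at hfin ⊢
      refine ⟨hfin.1, fun S' hS' => le_trans ?_ (hfin.2 S' hS')⟩
      have : 0 ≤ ∑ u ∈ S', (ctilde u ω : ℝ) := Finset.sum_nonneg fun _ _ => Nat.cast_nonneg _
      nlinarith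

/-- Logarithm of cover size times survival bound. With `a = log n`, `b = log (n / ε)`, `e = ε⁻²`,
the cover contributes `9 · 144 μ a e ≤ 1944 μ a b e` since `b ≥ 2 / 3`; the terms `2` and `μ b` add
at most `6 μ a b e`, and the decay supplies `2000 μ a b e`. -/
theorem union_bound_exponent {n : ℕ} (hn : 2 ≤ n) {ε p D T μ : ℝ} (hε : 0 < ε) (hε1 : ε < 1)
    (hp : 0 < p) (hD : 0 < D) (hμ : 1 ≤ μ)
    (hT : 4000 * D * Real.log n * Real.log (n / ε) / (ε ^ 3 * p) ≤ T) :
    9 * (μ / (ε / 12) ^ 2) * Real.log n + 2 - p * (ε / 2 * μ / D) * T ≤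
      -(μ * Real.log (n / ε)) := by
  set a := Real.log n with ha
  set b := Real.log (n / ε) with hb
  have hn' : (2 : ℝ) ≤ n := by exact_mod_cast hn
  have ha1 : 2 / 3 ≤ a := by
    have h1 : Real.log 2 ≤ a := Real.log_le_log (by norm_num) hn'
    linarith [Real.log_two_gt_d9]
  have hb1 : 2 / 3 ≤ b := by
    refine ha1.trans (Real.log_le_log (by linarith) ?_)
    rw [le_div_iff₀ hε]
    nlinarith
  set e : ℝ := (ε ^ 2)⁻¹ with he
  have he1 : 1 ≤ e := (one_le_inv₀ (by positivity)).2 (pow_le_one₀ hε.le hε1.le)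
  have hTe : 2000 * μ * (a * b * e) ≤ p * (ε / 2 * μ / D) * T := by
    calc 2000 * μ * (a * b * e) =
          p * (ε / 2 * μ / D) * (4000 * D * a * b / (ε ^ 3 * p)) := by
            rw [he]
            field_simp
            norm_num
      _ ≤ _ := mul_le_mul_of_nonneg_left hT (by positivity)
  have h0 : 9 * (μ / (ε / 12) ^ 2) * a = 1296 * μ * (a * e) := by
    rw [he]
    field_simp
    norm_num
  have hab : a ≤ 3 / 2 * (a * b) := by nlinarith
  have hae : a * e ≤ 3 / 2 * (a * b * e) := by nlinarith
  have hbe : b ≤ 3 / 2 * (a * b * e) := by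
    have h1 : b ≤ 3 / 2 * (a * b) := by nlinarith
    have h2 : a * b ≤ a * b * e := le_mul_of_one_le_right (by positivity) he1
    linarith
  have h2 : 2 ≤ μ * (3 * b) := by nlinarith
  rw [h0]
  have h3 := mul_le_mul_of_nonneg_left hae (by linarith : (0 : ℝ) ≤ 1296 * μ)
  have h4 := mul_le_mul_of_nonneg_left hbe (by linarith : (0 : ℝ) ≤ 4 * μ)
  have h5 : 0 ≤ μ * (a * b * e) := by positivity
  nlinarith

theorem ofReal_le_successProb (hn : 2 ≤ Fintype.card V) (hG : IsTPerfect G) (hε : 0 < ε)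
    (hε1 : ε < 1) (hmeas : ∀ j, Measurable (ctilde j)) (hind : iIndepFun ctilde Pr)
    (hbox : ∀ j, ∀ᵐ ω ∂Pr, ctilde j ω ∈ Set.Icc (cminus j) (cplus j)) (hp0 : 0 < p)
    (hp : ∀ j, p ≤ Pr.real {ω | ctilde j ω = cplus j}) (s : AdaptiveStrategy G) (T : ℕ)
    (hT : 4000 * ((Finset.univ.sup fun j => cplus j - cminus j : ℕ) : ℝ)
      * Real.log (Fintype.card V) * Real.log (Fintype.card V / ε) / (ε ^ 3 * p) ≤ T) :
    ENNReal.ofReal (1 - ε) ≤ s.successProb Pr cminus cplus ctilde T (1 - ε) := by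
  classical
  rcases Nat.eq_zero_or_pos (Finset.univ.sup fun j => cplus j - cminus j : ℕ) with hD | hD
  · refine le_trans ?_ (one_le_successProb_of_sup_eq_zero hbox hε s hD T)
    rw [ENNReal.ofReal_le_one]
    linarith
  set D : ℕ := Finset.univ.sup fun j => cplus j - cminus j with hDdef
  set n := Fintype.card V with hnV
  have hn' : (2 : ℝ) ≤ n := by exact_mod_cast hn
  have hp1 : p ≤ 1 := by
    obtain ⟨j⟩ : Nonempty V := Fintype.card_pos_iff.1 (by omega)
    exact (hp j).trans measureReal_le_one
  have hsparse : (stableSystem G).boxed.IsSparse n :=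
    (isSparse_stableSystem hn).boxed hn (sum_stableSystem_le hn)
  set θ : ℝ := (ε / 12) ^ 2 with hθ
  have hθ0 : 0 < θ := by positivity
  have hfin : ∀ m : ℕ, 1 ≤ m → ((stableSystem G).boxed.discretizedDuals θ ε m).Finite := fun m hm =>
    (hsparse.finite_and_ncard_le hn hε hθ0 (by exact_mod_cast hm)).1
  -- The empty default at `m = 0` is harmless, as only the covers `W (m + 1)` enter the union bound.
  set W : ℕ → Finset (EdgeOrOddCycle G ⊕ V → ℝ) := fun m =>
    if hm : 1 ≤ m then (hfin m hm).toFinset else ∅ with hWdef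
  have hWmem : ∀ m : ℕ, 1 ≤ m → ∀ y,
      y ∈ W m ↔ y ∈ (stableSystem G).boxed.discretizedDuals θ ε m := by
    intro m hm y
    simp only [hWdef, hm, dif_pos, Set.Finite.mem_toFinset]
  have hWcard : ∀ m : ℕ, 1 ≤ m → ((W m).card : ℝ) ≤ Real.exp (9 * (m / θ) * Real.log n + 2) := by
    intro m hm
    have := (hsparse.finite_and_ncard_le hn hε hθ0 (μ := m) (by exact_mod_cast hm)).2
    rw [Set.ncard_eq_toFinset_card _ (hfin m hm)] at this
    simpa only [hWdef, hm, dif_pos] using this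
  have hW : ∀ m : ℕ, 1 ≤ m → ∀ (c : V → ℕ) (y : EdgeOrOddCycle G ⊕ V → ℝ), (∀ i, 0 ≤ y i) →
      (stableSystem G).boxed.dualValue y ≤ (1 - ε) * m → (stableSystem G).boxed.DualCovers c y →
      ∃ y' ∈ W m, (stableSystem G).boxed.DualCovers c y' := by
    intro m hm c y hy hval hcov
    obtain ⟨y', h1, h2⟩ := hsparse.exists_discretized hε hε1 hθ0 le_rfl
      (by exact_mod_cast hm) hy hval hcov
    exact ⟨y', (hWmem m hm y').2 h1, h2⟩
  set f : ℕ → (EdgeOrOddCycle G ⊕ V → ℝ) → (V → ℕ) → ENNReal := fun m y c =>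
    ∑' h, s.queries cplus c T h *
      (if Survives G cminus cplus ((m + 1 : ℕ) : ℝ) y c h then 1 else 0) with hf
  have hfint : ∀ m, ∀ y ∈ W (m + 1), ∫⁻ ω, f m y (fun j => ctilde j ω) ∂Pr ≤
      ENNReal.ofReal (Real.exp (-(p * (ε / 2 * ((m + 1 : ℕ) : ℝ) / D) * T))) := by
    intro m y hy
    have hy' := (hWmem _ (Nat.le_add_left 1 m) y).1 hy
    refine lintegral_survives_le hmeas hind hbox hp0 hp s hD hp1 ?_ hy'.2 T
    obtain ⟨⟨k, hk⟩, -⟩ := hy'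
    intro i
    rw [hk]
    positivity
  have hterm : ∀ m : ℕ, ∑ y ∈ W (m + 1), ∫⁻ ω, f m y (fun j => ctilde j ω) ∂Pr ≤
      ENNReal.ofReal ε * (2⁻¹) ^ (m + 1) := by
    intro m
    have hm1 : (1 : ℝ) ≤ ((m + 1 : ℕ) : ℝ) := by exact_mod_cast Nat.le_add_left 1 m
    calc _ ≤ (W (m + 1)).card •
          ENNReal.ofReal (Real.exp (-(p * (ε / 2 * ((m + 1 : ℕ) : ℝ) / D) * T))) :=
          Finset.sum_le_card_nsmul _ _ _ (hfint m)
      _ = ENNReal.ofReal ((W (m + 1)).card *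
          Real.exp (-(p * (ε / 2 * ((m + 1 : ℕ) : ℝ) / D) * T))) := by
          rw [nsmul_eq_mul, ENNReal.ofReal_mul (Nat.cast_nonneg _), ENNReal.ofReal_natCast]
      _ ≤ ENNReal.ofReal (ε * (2⁻¹) ^ (m + 1)) := by
          refine ENNReal.ofReal_le_ofReal ?_
          calc _ ≤ Real.exp (9 * (((m + 1 : ℕ) : ℝ) / θ) * Real.log n + 2) *
                Real.exp (-(p * (ε / 2 * ((m + 1 : ℕ) : ℝ) / D) * T)) :=
                mul_le_mul_of_nonneg_right (hWcard _ (Nat.le_add_left 1 m)) (Real.exp_pos _).le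
            _ ≤ Real.exp (-(((m + 1 : ℕ) : ℝ) * Real.log (n / ε))) := by
                rw [← Real.exp_add, Real.exp_le_exp, ← sub_eq_add_neg]
                exact union_bound_exponent hn hε hε1 hp0 (by exact_mod_cast hD) hm1 hT
            _ = (ε / n) ^ (m + 1) := by
                rw [← mul_neg, ← Real.log_inv, inv_div, Real.exp_nat_mul, Real.exp_log]
                positivity
            -- `n ≥ 2` gives a geometric series in `m` with sum at most `ε`.
            _ ≤ (ε * 2⁻¹) ^ (m + 1) := by
                refine pow_le_pow_left₀ (by positivity) ?_ _
                rw [div_eq_mul_inv]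
                exact mul_le_mul_of_nonneg_left (inv_anti₀ (by norm_num) hn') hε.le
            _ ≤ _ := by
                rw [mul_pow]
                refine mul_le_mul_of_nonneg_right ?_ (by positivity)
                exact pow_le_of_le_one hε.le hε1.le (Nat.succ_ne_zero m)
      _ = _ := by
          rw [ENNReal.ofReal_mul hε.le, ENNReal.ofReal_pow (by norm_num),
            ENNReal.ofReal_inv_of_pos (by norm_num), ENNReal.ofReal_ofNat]
  have hfm : ∀ m, Measurable fun ω => ∑ y ∈ W (m + 1), f m y fun j => ctilde j ω := fun m =>
    measurable_comp_weights hmeas fun c => ∑ y ∈ W (m + 1), f m y c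
  have hone : 1 ≤ s.successProb Pr cminus cplus ctilde T (1 - ε) + ENNReal.ofReal ε := by
    calc (1 : ENNReal) = ∫⁻ _ω, 1 ∂Pr := by simp
      _ ≤ ∫⁻ ω, ((s.output cminus cplus (fun j => ctilde j ω) T).toOuterMeasure
            {S | IsApproxStableSet G (1 - ε) (fun j => ctilde j ω) S} +
            ∑' m : ℕ, ∑ y ∈ W (m + 1), f m y fun j => ctilde j ω) ∂Pr := by
          refine lintegral_mono_ae ?_
          filter_upwards [ae_all_iff.2 hbox] with ω hω
          exact one_le_success_add_survives hG hW s hω T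
      _ = s.successProb Pr cminus cplus ctilde T (1 - ε) +
            ∑' m : ℕ, ∑ y ∈ W (m + 1), ∫⁻ ω, f m y (fun j => ctilde j ω) ∂Pr := by
          rw [lintegral_add_right _ (Measurable.tsum hfm),
            lintegral_tsum fun m => (hfm m).aemeasurable]
          congr 1
          refine tsum_congr fun m => lintegral_finsetSum _ fun y _ => ?_
          exact measurable_comp_weights hmeas fun c => f m y c
      _ ≤ s.successProb Pr cminus cplus ctilde T (1 - ε) +
            ∑' m : ℕ, ENNReal.ofReal ε * (2⁻¹) ^ (m + 1) := by
          gcongr with m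
          exact hterm m
      _ = _ := by
          rw [ENNReal.tsum_mul_left, ENNReal.tsum_geometric_add_one, ENNReal.one_sub_inv_two,
            inv_inv, ENNReal.inv_mul_cancel (by norm_num) (by norm_num), mul_one]
  rw [ENNReal.ofReal_sub _ hε.le, ENNReal.ofReal_one]
  exact tsub_le_iff_right.2 hone

end Main

end StochPack

theorem mainTheorem12 :
    ∃ K κ L : ℝ, 0 < K ∧ 0 < κ ∧ 0 < L ∧
      ∀ (V : Type*) [Fintype V] [DecidableEq V] (G : SimpleGraph V),
        2 ≤ Fintype.card V → StochPack.IsTPerfect G →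
        ∀ ε : ℝ, 0 < ε → ε < 1 →
          -- the adaptive strategy
          (∀ (Ω : Type*) [MeasurableSpace Ω] (Pr : Measure Ω) [IsProbabilityMeasure Pr]
            (cminus cplus : V → ℕ) (ctilde : V → Ω → ℕ) (p : ℝ),
            (∀ j, Measurable (ctilde j)) → iIndepFun ctilde Pr →
            (∀ j, ∀ᵐ ω ∂Pr, ctilde j ω ∈ Set.Icc (cminus j) (cplus j)) →
            0 < p → (∀ j, p ≤ Pr.real {ω | ctilde j ω = cplus j}) →
            ∀ (s : StochPack.AdaptiveStrategy G) (T : ℕ),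
              K * ((Finset.univ.sup fun j => cplus j - cminus j : ℕ) : ℝ)
                  * Real.log (Fintype.card V) * Real.log (Fintype.card V / ε) / (ε ^ 3 * p) ≤ T →
              ENNReal.ofReal (1 - ε) ≤ s.successProb Pr cminus cplus ctilde T (1 - ε)) ∧
          -- the witness cover
          (∀ θ : ℝ, 0 < θ → θ ≤ κ * ε ^ 2 / Real.log (Fintype.card V) → ∀ μ : ℝ, 1 ≤ μ →
            (StochPack.stableSystem G).IsWitnessCover ε (ε / 2) μ
              ((StochPack.stableSystem G).discretizedDuals θ ε μ) ∧
            (((StochPack.stableSystem G).discretizedDuals θ ε μ).ncard : ℝ)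
              ≤ Real.exp (L * (μ / θ) * Real.log (Fintype.card V))) := by
  -- Since `log n ≥ 2 / 3`, `κ = 1 / 300` gives `θ ≤ ε² / 200 ≤ (ε / 12)²`, as the rounding
  -- requires. `L = 10` is the 9 of the count plus 1, which absorbs the additive 2 in the exponent.
  refine ⟨4000, 1 / 300, 10, by norm_num, by norm_num, by norm_num, ?_⟩
  intro V _ _ G hn hG ε hε hε1
  refine ⟨?_, ?_⟩
  · intro Ω _ Pr _ cminus cplus ctilde p hmeas hind hbox hp0 hp s T hT
    exact StochPack.ofReal_le_successProb hn hG hε hε1 hmeas hind hbox hp0 hp s T hT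
  · intro θ hθ hθε μ hμ
    have hsparse := StochPack.isSparse_stableSystem (G := G) hn
    set a := Real.log (Fintype.card V) with ha
    have ha1 : 2 / 3 ≤ a := by
      have h1 : Real.log 2 ≤ a := Real.log_le_log (by norm_num) (by exact_mod_cast hn)
      linarith [Real.log_two_gt_d9]
    have hθa : θ * a ≤ ε ^ 2 / 300 := by
      rw [le_div_iff₀ (by linarith)] at hθε
      linarith
    refine ⟨hsparse.isWitnessCover hn hε hε1 hθ ?_ hμ,
      (hsparse.finite_and_ncard_le hn hε hθ hμ).2.trans (Real.exp_le_exp.2 ?_)⟩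
    · nlinarith
    · have h1 : 2 ≤ μ / θ * a := by
        rw [div_mul_eq_mul_div, le_div_iff₀ hθ]
        nlinarith
      rw [← ha]
      linarith
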